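/- Let $K$ be a division ring, $S$ a ring endomorphism of $K$, and $D$ an $S$-derivation of $K$, i.e. an additive map with $D(ab)=S(a)D(b)+D(a)b$. Let $R=K[t,S,D]$ be the Ore skew polynomial ring of left polynomials $\sum b_it^i$ ($b_i\in K$) with $tb=S(b)t+D(b)$. For $f=\sum b_it^i\in R$ and $a\in K$ put $f(a)=\sum b_iN_i(a)$, where $N_0(a)=1$ and $N_{i+1}(a)=S(N_i(a))a+D(N_i(a))$, and let $V(f)=\{a\in K: f(a)=0\}$. A set $\Delta\subseteq K$ is algebraic if $\Delta\subseteq V(f)$ for some nonzero $f\in R$; then its minimal polynomial $f_\Delta$ is the monic generator of the left ideal of all polynomials vanishing on $\Delta$, its rank is $\mathrm{rk}(\Delta)=\deg f_\Delta$, and $\Delta$ is full if $\Delta=V(f_\Delta)$. Let $\mathcal F$ be the set of full algebraic sets, ordered by inclusion. Let $\mathcal W$ be the set of W-polynomials, i.e. of the minimal polynomials of algebraic sets, ordered by $f\le h\iff Rf\subseteq Rh$; its largest element is $1$. If $K$ is algebraic, put $\mathcal F^*=\mathcal F$ and $\mathcal W^*=\mathcal W$. Otherwise put $\mathcal F^*=\mathcal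 F\cup\{K\}$ with largest element $K$ and $\mathcal W^*=\mathcal W\cup\{0\}$ with smallest element $0$, and set $f_K=0$, $V(0)=K$, $\mathrm{rk}(K)=\infty$, $\deg 0=\infty$. **Theorem 7.5.** 1. $\mathcal F^*$ and $\mathcal W^*$ are complete modular lattices, and the maps $\Delta\mapsto f_\Delta$ and $f\mapsto V(f)$ are mutually inverse order-reversing bijections (lattice dualities) between $\mathcal F^*$ and $\mathcal W^*$. 2. $\mathrm{rk}$ is the dimension function of $\mathcal F^*$, and $\deg$ is the dual dimension function of $\mathcal W^*$ (the dimension function of the dual lattice). Here the dimension function $d$ of a modular lattice gives for each $x$ the supremum $d(x)\in\mathbb N\cup\{\infty\}$ of the lengths of the finite chains ending in $x$; it also satisfies $d(y)=d(x)+1$ whenever $y$ covers $x$, and $d(x)+d(y)=d(x\vee y)+d(x\wedge y)$ for all $x,y$. 3. The atoms of $\mathcal F^*$ are exactly the singleton subsets of $K$, and the maximal elements of $\mathcal W\setminus\{1\}$ are exactly the monic linear polynomials of $R$. 4. For $f\le h$ in $\mathcal W$, the interval $[f,h]=\{g\in\mathcal W: f\le g\le h\}$ is isomorphic, as a lattice,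 to the lattice of all $R$-submodules of $Rh/Rf$. -/

import Mathlib

universe u

/-- An `S`-derivation of `K`: an additive map with `D (a b) = S a * D b + D a * b`. -/
structure SDerivation {K : Type u} [DivisionRing K] (S : K →+* K) extends K →+ K where
  leibniz' : ∀ a b : K, toFun (a * b) = S a * toFun b + toFun a * b

/-- The underlying type of the Ore skew polynomial ring `K[t, S, D]`: the finitely supported
sequence `i ↦ bᵢ` stands for the polynomial `∑ bᵢ tⁱ` with coefficients on the left. -/
def OrePoly {K : Type u} [DivisionRing K] (S : K →+* K) (_D : SDerivation S) : Type u := ℕ →₀ K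

namespace OrePoly

variable {K : Type u} [DivisionRing K] {S : K →+* K} {D : SDerivation S}

noncomputable instance : AddCommGroup (OrePoly S D) := inferInstanceAs (AddCommGroup (ℕ →₀ K))

noncomputable instance : Module K (OrePoly S D) := inferInstanceAs (Module K (ℕ →₀ K))

/-- The coefficient of `tⁿ`. -/
def coeff (f : OrePoly S D) (n : ℕ) : K := Finsupp.toFun f n

/-- The polynomial `b tⁿ`, as an additive function of `b`. -/
noncomputable def monomial (n : ℕ) : K →+ OrePoly S D := Finsupp.singleAddHom n

theorem ext_coeff {f g : OrePoly S D} (h : ∀ n, f.coeff n = g.coeff n) : f = g :=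
  Finsupp.ext h

@[simp] theorem coeff_zero (n : ℕ) : (0 : OrePoly S D).coeff n = 0 := rfl

@[simp] theorem coeff_add (f g : OrePoly S D) (n : ℕ) :
    (f + g).coeff n = f.coeff n + g.coeff n := rfl

@[simp] theorem coeff_sub (f g : OrePoly S D) (n : ℕ) :
    (f - g).coeff n = f.coeff n - g.coeff n := rfl

@[simp] theorem coeff_smul (b : K) (f : OrePoly S D) (n : ℕ) :
    (b • f).coeff n = b * f.coeff n := rfl

theorem coeff_monomial (n : ℕ) (b : K) (k : ℕ) :
    (monomial n b : OrePoly S D).coeff k = if n = k then b else 0 :=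
  Finsupp.single_apply

theorem smul_monomial (n : ℕ) (b c : K) :
    b • (monomial n c : OrePoly S D) = monomial n (b * c) := by
  apply ext_coeff; intro k
  rw [coeff_smul, coeff_monomial, coeff_monomial]; split_ifs <;> simp

/-- The additive map out of the polynomials with prescribed values on all `b tⁱ`. -/
noncomputable def lift {A : Type*} [AddCommMonoid A] (φ : ℕ → K →+ A) : OrePoly S D →+ A :=
  Finsupp.liftAddHom φ

@[simp] theorem lift_monomial {A : Type*} [AddCommMonoid A] (φ : ℕ → K →+ A) (n : ℕ) (b : K) :
    lift φ (monomial n b : OrePoly S D) = φ n b :=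
  Finsupp.liftAddHom_apply_single φ n b

theorem hom_ext {A : Type*} [AddCommMonoid A] {φ ψ : OrePoly S D →+ A}
    (h : ∀ n b, φ (monomial n b) = ψ (monomial n b)) : φ = ψ :=
  Finsupp.addHom_ext h

/-- Left multiplication by `t`: the additive map `b tⁱ ↦ S(b) tⁱ⁺¹ + D(b) tⁱ`. -/
noncomputable def tMul : AddMonoid.End (OrePoly S D) :=
  lift fun i => (monomial (i + 1)).comp S.toAddMonoidHom + (monomial i).comp D.toAddMonoidHom

theorem tMul_monomial (n : ℕ) (b : K) :
    tMul (monomial n b : OrePoly S D) =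
      monomial (n + 1) (S b) + monomial n (D.toAddMonoidHom b) :=
  lift_monomial _ n b

theorem tMul_smul (b : K) (f : OrePoly S D) :
    tMul (b • f) = S b • tMul f + D.toAddMonoidHom b • f := by
  let φ : OrePoly S D →+ OrePoly S D := (tMul : OrePoly S D →+ OrePoly S D).comp
    (smulAddHom K (OrePoly S D) b)
  let ψ : OrePoly S D →+ OrePoly S D := (smulAddHom K (OrePoly S D) (S b)).comp tMul +
    smulAddHom K (OrePoly S D) (D.toAddMonoidHom b)
  have h : φ = ψ := by
    apply hom_ext
    intro n c
    change tMul (b • monomial n c) = S b • tMul (monomial n c) +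
      D.toAddMonoidHom b • monomial n c
    have hl : D.toAddMonoidHom (b * c) = S b * D.toAddMonoidHom c + D.toAddMonoidHom b * c :=
      D.leibniz' b c
    rw [smul_monomial, tMul_monomial, tMul_monomial, smul_add, smul_monomial, smul_monomial,
      smul_monomial, map_mul, hl, map_add]
    abel
  exact DFunLike.congr_fun h f

/-- Left multiplication: `∑ bᵢ tⁱ` acts as `∑ bᵢ • tMulⁱ`. -/
noncomputable def mulHom : OrePoly S D →+ AddMonoid.End (OrePoly S D) :=
  lift fun i =>
    { toFun := fun b => (smulAddHom K (OrePoly S D) b).comp (tMul ^ i : AddMonoid.End (OrePoly S D))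
      map_zero' := by rw [map_zero]; rfl
      map_add' := fun a b => by rw [map_add]; rfl }

theorem mulHom_monomial (n : ℕ) (b : K) (g : OrePoly S D) :
    mulHom (monomial n b) g = b • (tMul ^ n : AddMonoid.End (OrePoly S D)) g := by
  unfold mulHom; rw [lift_monomial]; rfl

noncomputable instance : Mul (OrePoly S D) := ⟨fun f g => mulHom f g⟩

noncomputable instance : One (OrePoly S D) := ⟨monomial 0 1⟩

theorem one_def : (1 : OrePoly S D) = monomial 0 1 := rfl

theorem mul_def (f g : OrePoly S D) : f * g = mulHom f g := rfl

theorem monomial_mul (n : ℕ) (b : K) (g : OrePoly S D) :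
    monomial n b * g = b • (tMul ^ n : AddMonoid.End (OrePoly S D)) g :=
  mulHom_monomial n b g

theorem induction_on {p : OrePoly S D → Prop} (f : OrePoly S D)
    (h : ∀ n b, p (monomial n b)) (h0 : p 0) (hadd : ∀ f g, p f → p g → p (f + g)) : p f :=
  Finsupp.induction_linear (motive := p) f h0 hadd h

theorem mulHom_add_apply (f g h : OrePoly S D) :
    mulHom (f + g) h = mulHom f h + mulHom g h := by
  rw [map_add]; rfl

theorem mulHom_smul (b : K) (f g : OrePoly S D) : mulHom (b • f) g = b • mulHom f g := by
  induction f using induction_on with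
  | h n c => rw [smul_monomial, mulHom_monomial, mulHom_monomial, mul_smul]
  | h0 => simp
  | hadd f₁ f₂ h₁ h₂ =>
    rw [smul_add, mulHom_add_apply, mulHom_add_apply, h₁, h₂, smul_add]

theorem mulHom_tMul (f g : OrePoly S D) : mulHom (tMul f) g = tMul (mulHom f g) := by
  induction f using induction_on with
  | h n c =>
    rw [tMul_monomial, mulHom_add_apply, mulHom_monomial, mulHom_monomial, mulHom_monomial,
      tMul_smul, pow_succ']
    rfl
  | h0 => simp
  | hadd f₁ f₂ h₁ h₂ =>
    rw [map_add, mulHom_add_apply, mulHom_add_apply, h₁, h₂, map_add]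

theorem mulHom_tMul_pow (n : ℕ) (f g : OrePoly S D) :
    mulHom ((tMul ^ n : AddMonoid.End (OrePoly S D)) f) g =
      (tMul ^ n : AddMonoid.End (OrePoly S D)) (mulHom f g) := by
  induction n with
  | zero => rfl
  | succ n ih =>
    rw [pow_succ']
    change mulHom (tMul ((tMul ^ n : AddMonoid.End (OrePoly S D)) f)) g =
      tMul ((tMul ^ n : AddMonoid.End (OrePoly S D)) (mulHom f g))
    rw [mulHom_tMul, ih]

theorem mulHom_mulHom (f g h : OrePoly S D) : mulHom (mulHom f g) h = mulHom f (mulHom g h) := by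
  induction f using induction_on with
  | h n c => rw [mulHom_monomial, mulHom_monomial, mulHom_smul, mulHom_tMul_pow]
  | h0 => simp
  | hadd f₁ f₂ h₁ h₂ =>
    rw [mulHom_add_apply, mulHom_add_apply, h₁, h₂, mulHom_add_apply]

theorem mulHom_one (f : OrePoly S D) : mulHom f 1 = f := by
  induction f using induction_on with
  | h n c =>
    rw [mulHom_monomial]
    have h : (tMul ^ n : AddMonoid.End (OrePoly S D)) 1 = monomial n 1 := by
      induction n with
      | zero => rfl
      | succ n ih =>
        rw [pow_succ']
        change tMul ((tMul ^ n : AddMonoid.End (OrePoly S D)) 1) = _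
        have h1 : D.toAddMonoidHom 1 = 0 := by
          have h2 : D.toAddMonoidHom (1 * 1) =
            S 1 * D.toAddMonoidHom 1 + D.toAddMonoidHom 1 * 1 := D.leibniz' 1 1
          simpa using h2
        rw [ih, tMul_monomial, map_one, h1, map_zero, add_zero]
    rw [h, smul_monomial, mul_one]
  | h0 => simp
  | hadd f₁ f₂ h₁ h₂ => rw [mulHom_add_apply, h₁, h₂]

/-- The ring structure of `K[t, S, D]`. -/
noncomputable instance : Ring (OrePoly S D) :=
  { (inferInstance : AddCommGroup (OrePoly S D)) with
    mul := fun f g => f * g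
    one := 1
    left_distrib := fun f g h => map_add (mulHom f) g h
    right_distrib := mulHom_add_apply
    zero_mul := fun f => by
      change mulHom 0 f = 0
      rw [map_zero]; rfl
    mul_zero := fun f => map_zero (mulHom f)
    mul_assoc := mulHom_mulHom
    one_mul := fun f => by
      change mulHom (monomial 0 1) f = f
      rw [mulHom_monomial, pow_zero, one_smul]; rfl
    mul_one := mulHom_one }

/-- The indeterminate `t`. -/
noncomputable def T : OrePoly S D := monomial 1 1

/-- The constant polynomial `b`. -/
noncomputable def C (b : K) : OrePoly S D := monomial 0 b

/-- The defining commutation rule `t b = S(b) t + D(b)`. -/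
theorem T_mul_C (b : K) :
    (T : OrePoly S D) * C b = C (S b) * T + C (D.toAddMonoidHom b) := by
  unfold T C
  rw [monomial_mul, monomial_mul, pow_one, pow_zero, one_smul, tMul_monomial]
  change _ = S b • monomial 1 1 + _
  rw [smul_monomial, mul_one]

theorem C_mul (b : K) (f : OrePoly S D) : C b * f = b • f := by
  unfold C; rw [monomial_mul, pow_zero]; rfl

theorem C_mul_T_pow (n : ℕ) (b : K) : (C b * T ^ n : OrePoly S D) = monomial n b := by
  have hT : ∀ f : OrePoly S D, T * f = tMul f := fun f => by
    unfold T; rw [monomial_mul, pow_one, one_smul]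
  have h : ∀ f : OrePoly S D, T ^ n * f = (tMul ^ n : AddMonoid.End (OrePoly S D)) f := by
    intro f
    induction n with
    | zero => rw [pow_zero, one_mul]; rfl
    | succ n ih => rw [pow_succ', mul_assoc, ih, hT, pow_succ']; rfl
  rw [C_mul, ← mul_one (T ^ n), h]
  have := monomial_mul n b (1 : OrePoly S D)
  rw [mul_one] at this
  exact this.symm

/-! ### Degree -/

/-- The degree of `f` (equal to `0` for `f = 0`). -/
def natDegree (f : OrePoly S D) : ℕ := (Finsupp.support f).sup id

/-- Monic polynomials. -/
def Monic (f : OrePoly S D) : Prop := f.coeff f.natDegree = 1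

theorem coeff_eq_zero_of_natDegree_lt {f : OrePoly S D} {k : ℕ} (h : f.natDegree < k) :
    f.coeff k = 0 := by
  by_contra hk
  have : k ∈ Finsupp.support f := Finsupp.mem_support_iff.2 hk
  exact absurd (Finset.le_sup (f := id) this) (not_le.2 h)

theorem natDegree_eq {f : OrePoly S D} {n : ℕ} (h : ∀ k, n < k → f.coeff k = 0)
    (hn : f.coeff n ≠ 0) : f.natDegree = n := by
  apply le_antisymm
  · apply Finset.sup_le
    intro k hk
    by_contra hlt
    exact (Finsupp.mem_support_iff.1 hk) (h k (not_le.1 hlt))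
  · by_contra hlt
    exact hn (coeff_eq_zero_of_natDegree_lt (not_le.1 hlt))

theorem coeff_natDegree_ne_zero {f : OrePoly S D} (h : f ≠ 0) : f.coeff f.natDegree ≠ 0 := by
  have hne : (Finsupp.support f).Nonempty := Finsupp.support_nonempty_iff.2 h
  obtain ⟨k, hk, hk'⟩ := Finset.exists_mem_eq_sup _ hne id
  have : f.natDegree = k := hk'
  rw [this]
  exact Finsupp.mem_support_iff.1 hk

theorem Monic.ne_zero {f : OrePoly S D} (h : f.Monic) : f ≠ 0 := by
  rintro rfl
  exact zero_ne_one h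

theorem monic_one : (1 : OrePoly S D).Monic := by
  have h : (1 : OrePoly S D).natDegree = 0 := by
    apply natDegree_eq
    · intro k hk; rw [one_def, coeff_monomial, if_neg hk.ne]
    · rw [one_def, coeff_monomial]; simp
  unfold Monic; rw [h, one_def, coeff_monomial]; simp

theorem coeff_tMul_zero (f : OrePoly S D) : (tMul f).coeff 0 = D.toAddMonoidHom (f.coeff 0) := by
  induction f using induction_on with
  | h n c =>
    rw [tMul_monomial, coeff_add, coeff_monomial, coeff_monomial, coeff_monomial]
    split_ifs <;> simp_all
  | h0 => simp
  | hadd f₁ f₂ h₁ h₂ => rw [map_add, coeff_add, h₁, h₂, coeff_add, map_add]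

theorem coeff_tMul_succ (f : OrePoly S D) (k : ℕ) :
    (tMul f).coeff (k + 1) = S (f.coeff k) + D.toAddMonoidHom (f.coeff (k + 1)) := by
  induction f using induction_on with
  | h n c =>
    rw [tMul_monomial, coeff_add, coeff_monomial, coeff_monomial, coeff_monomial, coeff_monomial]
    split_ifs <;> simp_all
  | h0 => simp
  | hadd f₁ f₂ h₁ h₂ =>
    rw [map_add, coeff_add, h₁, h₂, coeff_add, map_add, coeff_add, map_add]; abel

theorem coeff_tMul_pow {g : OrePoly S D} (hg : g.Monic) (i : ℕ) :
    (∀ k, i + g.natDegree < k → ((tMul ^ i : AddMonoid.End (OrePoly S D)) g).coeff k = 0) ∧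
      ((tMul ^ i : AddMonoid.End (OrePoly S D)) g).coeff (i + g.natDegree) = 1 := by
  induction i with
  | zero =>
    refine ⟨fun k hk => ?_, ?_⟩
    · exact coeff_eq_zero_of_natDegree_lt (f := g) (by omega)
    · rw [Nat.zero_add]; exact hg
  | succ i ih =>
    have e : (tMul ^ (i + 1) : AddMonoid.End (OrePoly S D)) g =
      tMul ((tMul ^ i : AddMonoid.End (OrePoly S D)) g) := by rw [pow_succ']; rfl
    rw [e]
    refine ⟨fun k hk => ?_, ?_⟩
    · obtain ⟨k, rfl⟩ : ∃ j, k = j + 1 := ⟨k - 1, by omega⟩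
      rw [coeff_tMul_succ, ih.1 k (by omega), ih.1 (k + 1) (by omega), map_zero, map_zero,
        add_zero]
    · rw [show i + 1 + g.natDegree = (i + g.natDegree) + 1 by omega, coeff_tMul_succ, ih.2,
        ih.1 _ (by omega), map_zero, map_one, add_zero]

theorem coeff_mul (f g : OrePoly S D) (k : ℕ) :
    (f * g).coeff k = ∑ i ∈ Finsupp.support f,
      f.coeff i * ((tMul ^ i : AddMonoid.End (OrePoly S D)) g).coeff k := by
  have h : f * g = ∑ i ∈ Finsupp.support f,
      f.coeff i • (tMul ^ i : AddMonoid.End (OrePoly S D)) g := by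
    have h1 : f = ∑ i ∈ Finsupp.support f, monomial i (f.coeff i) := (Finsupp.sum_single f).symm
    conv_lhs => rw [h1]
    rw [Finset.sum_mul]
    exact Finset.sum_congr rfl fun i _ => monomial_mul _ _ _
  rw [h]
  exact Finsupp.finsetSum_apply _ _ _

theorem natDegree_mul_monic {f g : OrePoly S D} (hf : f ≠ 0) (hg : g.Monic) :
    (f * g).natDegree = f.natDegree + g.natDegree ∧
      (f * g).coeff (f.natDegree + g.natDegree) = f.coeff f.natDegree := by
  have hle : ∀ i ∈ Finsupp.support f, i ≤ f.natDegree := fun i hi =>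
    Finset.le_sup (f := id) hi
  have h2 : (f * g).coeff (f.natDegree + g.natDegree) = f.coeff f.natDegree := by
    rw [coeff_mul, Finset.sum_eq_single f.natDegree]
    · rw [(coeff_tMul_pow hg _).2, mul_one]
    · intro i hi hne
      have := hle i hi
      rw [(coeff_tMul_pow hg _).1 _ (by omega), mul_zero]
    · intro h
      exact absurd (Finsupp.mem_support_iff.2 (coeff_natDegree_ne_zero hf)) h
  refine ⟨natDegree_eq ?_ (by rw [h2]; exact coeff_natDegree_ne_zero hf), h2⟩
  intro k hk
  rw [coeff_mul]
  apply Finset.sum_eq_zero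
  intro i hi
  have := hle i hi
  rw [(coeff_tMul_pow hg _).1 _ (by omega), mul_zero]

theorem eq_of_span_eq {f g : OrePoly S D} (hf : f.Monic) (hg : g.Monic)
    (h : Ideal.span {f} = Ideal.span {g}) : f = g := by
  have h1 : f ∈ Ideal.span {g} := h ▸ Ideal.mem_span_singleton_self f
  have h2 : g ∈ Ideal.span {f} := h ▸ Ideal.mem_span_singleton_self g
  obtain ⟨a, ha⟩ := Ideal.mem_span_singleton'.1 h1
  obtain ⟨b, hb⟩ := Ideal.mem_span_singleton'.1 h2
  have ha0 : a ≠ 0 := by rintro rfl; rw [zero_mul] at ha; exact hf.ne_zero ha.symm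
  have hb0 : b ≠ 0 := by rintro rfl; rw [zero_mul] at hb; exact hg.ne_zero hb.symm
  obtain ⟨da, ca⟩ := natDegree_mul_monic ha0 hg
  obtain ⟨db, -⟩ := natDegree_mul_monic hb0 hf
  rw [ha] at da ca
  rw [hb] at db
  have hd : a.natDegree = 0 := by omega
  have : a = 1 := by
    apply ext_coeff
    intro k
    rw [one_def, coeff_monomial]
    split_ifs with hk
    · subst hk
      rw [← da, hd] at ca
      rw [← ca]; exact hf
    · exact coeff_eq_zero_of_natDegree_lt (by omega)
  rw [← ha, this, one_mul]

/-! ### Evaluation, zero sets, minimal polynomials -/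

/-- The power functions `N₀(a) = 1`, `Nᵢ₊₁(a) = S(Nᵢ(a)) a + D(Nᵢ(a))`. -/
def powFun (D : SDerivation S) (a : K) : ℕ → K
  | 0 => 1
  | i + 1 => S (powFun D a i) * a + D.toAddMonoidHom (powFun D a i)

/-- The value `f(a) = ∑ bᵢ Nᵢ(a)` of `f = ∑ bᵢ tⁱ`, as an additive function of `f`. -/
noncomputable def eval (a : K) : OrePoly S D →+ K :=
  lift fun i => AddMonoidHom.mulRight (powFun D a i)

theorem eval_monomial (a : K) (n : ℕ) (b : K) :
    eval a (monomial n b : OrePoly S D) = b * powFun D a n := lift_monomial _ n b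

theorem eval_one (a : K) : eval a (1 : OrePoly S D) = 1 := by
  rw [one_def, eval_monomial]; exact mul_one 1

theorem eval_smul (a b : K) (f : OrePoly S D) : eval a (b • f) = b * eval a f := by
  induction f using induction_on with
  | h n c => rw [smul_monomial, eval_monomial, eval_monomial, mul_assoc]
  | h0 => simp
  | hadd f₁ f₂ h₁ h₂ => rw [smul_add, map_add, h₁, h₂, map_add, mul_add]

theorem eval_tMul (a : K) (f : OrePoly S D) :
    eval a (tMul f) = S (eval a f) * a + D.toAddMonoidHom (eval a f) := by
  induction f using induction_on with
  | h n c =>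
    have hl : D.toAddMonoidHom (c * powFun D a n) =
      S c * D.toAddMonoidHom (powFun D a n) + D.toAddMonoidHom c * powFun D a n :=
      D.leibniz' c _
    rw [tMul_monomial, map_add, eval_monomial, eval_monomial, eval_monomial, hl, map_mul, powFun,
      mul_add, mul_assoc]
    abel
  | h0 => simp
  | hadd f₁ f₂ h₁ h₂ => rw [map_add, map_add, h₁, h₂, map_add, map_add, map_add, add_mul]; abel

theorem eval_mul_eq_zero (a : K) (f g : OrePoly S D) (hg : eval a g = 0) :
    eval a (f * g) = 0 := by
  have hp : ∀ n : ℕ, eval a ((tMul ^ n : AddMonoid.End (OrePoly S D)) g) = 0 := by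
    intro n
    induction n with
    | zero => exact hg
    | succ n ih =>
      rw [pow_succ']
      change eval a (tMul ((tMul ^ n : AddMonoid.End (OrePoly S D)) g)) = 0
      rw [eval_tMul, ih, map_zero, map_zero, zero_mul, add_zero]
  induction f using induction_on with
  | h n c => rw [monomial_mul, eval_smul, hp, mul_zero]
  | h0 => rw [zero_mul, map_zero]
  | hadd f₁ f₂ h₁ h₂ => rw [add_mul, map_add, h₁, h₂, add_zero]

/-- The zero set `V(f)` of (right) roots of `f` in `K`. -/
def V (f : OrePoly S D) : Set K := {a | eval a f = 0}

/-- The left ideal of all polynomials vanishing on `Δ`. -/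
noncomputable def vanishing (S : K →+* K) (D : SDerivation S) (Δ : Set K) :
    Ideal (OrePoly S D) where
  carrier := {f | ∀ a ∈ Δ, eval a f = 0}
  add_mem' := fun hf hg a ha => by rw [map_add, hf a ha, hg a ha, add_zero]
  zero_mem' := fun a _ => map_zero (eval a)
  smul_mem' := fun c f hf a ha => eval_mul_eq_zero a c f (hf a ha)

/-- `(S, D)`-algebraic subsets of `K`. -/
def IsAlgebraicSet (S : K →+* K) (D : SDerivation S) (Δ : Set K) : Prop :=
  ∃ f : OrePoly S D, f ≠ 0 ∧ Δ ⊆ V f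

/-- `f` is the monic generator of the left ideal of polynomials vanishing on `Δ`. -/
def IsMinPoly (f : OrePoly S D) (Δ : Set K) : Prop :=
  f.Monic ∧ vanishing S D Δ = Ideal.span {f}

theorem IsMinPoly.unique {f g : OrePoly S D} {Δ : Set K} (hf : IsMinPoly f Δ)
    (hg : IsMinPoly g Δ) : f = g :=
  eq_of_span_eq hf.1 hg.1 (hf.2.symm.trans hg.2)

theorem exists_isMinPoly {Δ : Set K} (h : IsAlgebraicSet S D Δ) :
    ∃ f : OrePoly S D, IsMinPoly f Δ := by
  classical
  have hex : ∃ n, ∃ f : OrePoly S D, f ∈ vanishing S D Δ ∧ f ≠ 0 ∧ f.natDegree = n := by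
    obtain ⟨f, hf0, hf⟩ := h
    exact ⟨f.natDegree, f, fun a ha => hf ha, hf0, rfl⟩
  obtain ⟨g, hgI, hg0, hgn⟩ := Nat.find_spec hex
  have hmin : ∀ p : OrePoly S D, p ∈ vanishing S D Δ → p ≠ 0 → g.natDegree ≤ p.natDegree :=
    fun p hp hp0 => hgn ▸ Nat.find_min' hex ⟨p, hp, hp0, rfl⟩
  have hl : g.coeff g.natDegree ≠ 0 := coeff_natDegree_ne_zero hg0
  let f : OrePoly S D := C (g.coeff g.natDegree)⁻¹ * g
  have hfc : ∀ k, f.coeff k = (g.coeff g.natDegree)⁻¹ * g.coeff k := fun k => by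
    rw [← coeff_smul, ← C_mul]
  have hfd : f.natDegree = g.natDegree := by
    apply natDegree_eq
    · intro k hk; rw [hfc, coeff_eq_zero_of_natDegree_lt hk, mul_zero]
    · rw [hfc, inv_mul_cancel₀ hl]; exact one_ne_zero
  have hfm : f.Monic := by unfold Monic; rw [hfd, hfc, inv_mul_cancel₀ hl]
  have hfI : f ∈ vanishing S D Δ := (vanishing S D Δ).mul_mem_left _ hgI
  refine ⟨f, hfm, le_antisymm ?_ ((Ideal.span_singleton_le_iff_mem _).2 hfI)⟩
  have key : ∀ N : ℕ, ∀ p ∈ vanishing S D Δ, (∀ k, N ≤ k → p.coeff k = 0) →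
      p ∈ Ideal.span {f} := by
    intro N
    induction N with
    | zero =>
      intro p _ hp
      have : p = 0 := ext_coeff fun k => hp k (Nat.zero_le k)
      rw [this]; exact Ideal.zero_mem _
    | succ N ih =>
      intro p hpI hp
      by_cases hN : p.coeff N = 0
      · apply ih p hpI
        intro k hk
        rcases hk.eq_or_lt with rfl | hk
        · exact hN
        · exact hp k hk
      · have hpd : p.natDegree = N := natDegree_eq hp hN
        have hp0 : p ≠ 0 := by rintro rfl; exact hN rfl
        have hle : f.natDegree ≤ N := by rw [hfd, ← hpd]; exact hmin p hpI hp0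
        let q : OrePoly S D := monomial (N - f.natDegree) (p.coeff N)
        have hqd : q.natDegree = N - f.natDegree := by
          apply natDegree_eq
          · intro k hk; rw [coeff_monomial, if_neg hk.ne]
          · rw [coeff_monomial, if_pos rfl]; exact hN
        have hqc : q.coeff q.natDegree = p.coeff N := by
          rw [hqd, coeff_monomial, if_pos rfl]
        have hq0 : q ≠ 0 := by
          intro h0; apply hN; rw [← hqc, h0]; rfl
        obtain ⟨hd, hc⟩ := natDegree_mul_monic hq0 hfm
        have hsum : q.natDegree + f.natDegree = N := by omega
        rw [hsum] at hd hc
        have hmem : p - q * f ∈ Ideal.span {f} := by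
          apply ih _ (Submodule.sub_mem _ hpI ((vanishing S D Δ).mul_mem_left _ hfI))
          intro k hk
          rw [coeff_sub]
          rcases hk.eq_or_lt with rfl | hk
          · rw [hc, hqc, sub_self]
          · rw [hp k hk, coeff_eq_zero_of_natDegree_lt (by omega), sub_zero]
        have := Ideal.add_mem _ hmem
          (Ideal.mul_mem_left _ q (Ideal.mem_span_singleton_self f))
        rwa [sub_add_cancel] at this
  intro p hp
  exact key (p.natDegree + 1) p hp fun k hk => coeff_eq_zero_of_natDegree_lt hk

open Classical in
/-- The minimal polynomial `f_Δ` of an algebraic set `Δ`. For a set that is not algebraic only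
the zero polynomial vanishes on it, and `f_Δ` is set to be `0`. -/
noncomputable def minPoly (S : K →+* K) (D : SDerivation S) (Δ : Set K) : OrePoly S D :=
  if h : IsAlgebraicSet S D Δ then (exists_isMinPoly h).choose else 0

theorem isMinPoly_minPoly {Δ : Set K} (h : IsAlgebraicSet S D Δ) :
    IsMinPoly (minPoly S D Δ) Δ := by
  unfold minPoly; rw [dif_pos h]; exact (exists_isMinPoly h).choose_spec

open Classical in
/-- The rank of an algebraic set is the degree of its minimal polynomial; it is extended by `⊤`
to sets that are not algebraic. -/
noncomputable def rk (S : K →+* K) (D : SDerivation S) (Δ : Set K) : ℕ∞ :=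
  if IsAlgebraicSet S D Δ then ((minPoly S D Δ).natDegree : ℕ∞) else ⊤

open Classical in
/-- The degree, extended by `⊤` to the zero polynomial. -/
noncomputable def degTop (f : OrePoly S D) : ℕ∞ :=
  if f = 0 then ⊤ else (f.natDegree : ℕ∞)

/-- The P-closure `V(f_Δ)` of an algebraic set `Δ`. -/
noncomputable def pClosure (S : K →+* K) (D : SDerivation S) (Δ : Set K) : Set K :=
  V (minPoly S D Δ)

/-- Full algebraic sets: the algebraic sets that equal their P-closure. -/
def IsFull (S : K →+* K) (D : SDerivation S) (Δ : Set K) : Prop :=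
  IsAlgebraicSet S D Δ ∧ pClosure S D Δ = Δ

/-- The augmented poset of full algebraic sets, ordered by inclusion. If `K` is not algebraic,
then the set `K` itself serves as the largest element to be adjoined. -/
def FStar (S : K →+* K) (D : SDerivation S) : Set (Set K) :=
  {Δ | IsFull S D Δ ∨ (¬ IsAlgebraicSet S D (Set.univ : Set K) ∧ Δ = Set.univ)}

/-- The set of Wedderburn polynomials, the minimal polynomials of algebraic sets. -/
def W (S : K →+* K) (D : SDerivation S) : Set (OrePoly S D) :=
  {f | ∃ Δ : Set K, IsAlgebraicSet S D Δ ∧ f = minPoly S D Δ}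

/-- The augmented set of Wedderburn polynomials: `0` is adjoined if `K` is not algebraic. -/
def WStar (S : K →+* K) (D : SDerivation S) : Set (OrePoly S D) :=
  {f | f ∈ W S D ∨ (¬ IsAlgebraicSet S D (Set.univ : Set K) ∧ f = 0)}

theorem monic_of_mem_W {f : OrePoly S D} (h : f ∈ W S D) : f.Monic := by
  obtain ⟨Δ, hΔ, rfl⟩ := h
  exact (isMinPoly_minPoly hΔ).1

theorem span_injOn_WStar :
    Function.Injective (fun f : WStar S D => Ideal.span {(f : OrePoly S D)}) := by
  rintro ⟨f, hf⟩ ⟨g, hg⟩ h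
  have h : Ideal.span {f} = Ideal.span {g} := h
  apply Subtype.ext
  change f = g
  rcases hf with hf | ⟨-, rfl⟩ <;> rcases hg with hg | ⟨-, rfl⟩
  · exact eq_of_span_eq (monic_of_mem_W hf) (monic_of_mem_W hg) h
  · exact Ideal.span_singleton_eq_bot.1 (h.trans (Ideal.span_singleton_eq_bot.2 rfl))
  · exact (Ideal.span_singleton_eq_bot.1 (h.symm.trans (Ideal.span_singleton_eq_bot.2 rfl))).symm
  · rfl

/-- The order on `W`: `f ≤ h` iff `R f ⊆ R h`. -/
noncomputable instance : PartialOrder (W S D) :=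
  PartialOrder.lift (fun f : W S D => Ideal.span {(f : OrePoly S D)}) fun f g h =>
    Subtype.ext (eq_of_span_eq (monic_of_mem_W f.2) (monic_of_mem_W g.2) h)

/-- The order on the augmented set: `f ≤ h` iff `R f ⊆ R h`. -/
noncomputable instance : PartialOrder (WStar S D) :=
  PartialOrder.lift (fun f : WStar S D => Ideal.span {(f : OrePoly S D)}) span_injOn_WStar

theorem isAlgebraicSet_empty : IsAlgebraicSet S D (∅ : Set K) :=
  ⟨1, monic_one.ne_zero, Set.empty_subset _⟩

theorem minPoly_empty : minPoly S D (∅ : Set K) = 1 := by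
  refine (isMinPoly_minPoly isAlgebraicSet_empty).unique ⟨monic_one, ?_⟩
  rw [Ideal.span_singleton_one, eq_top_iff]
  intro f _ a ha
  exact absurd ha (Set.notMem_empty a)

theorem isFull_empty : IsFull S D (∅ : Set K) := by
  refine ⟨isAlgebraicSet_empty, ?_⟩
  unfold pClosure
  rw [minPoly_empty, Set.eq_empty_iff_forall_notMem]
  intro a ha
  have ha : eval a (1 : OrePoly S D) = 0 := ha
  rw [eval_one] at ha
  exact one_ne_zero ha

/-- The least element of the augmented poset of full algebraic sets is the empty set. -/
instance : OrderBot (FStar S D) where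
  bot := ⟨∅, Or.inl isFull_empty⟩
  bot_le := fun Δ => Set.empty_subset (Δ : Set K)

/-- The largest Wedderburn polynomial is `1`. -/
noncomputable instance : OrderTop (W S D) where
  top := ⟨1, ∅, isAlgebraicSet_empty, minPoly_empty.symm⟩
  le_top := fun f => by
    change Ideal.span {(f : OrePoly S D)} ≤ Ideal.span {(1 : OrePoly S D)}
    rw [Ideal.span_singleton_one]; exact le_top

end OrePoly

/-- The given partial order is a complete lattice, and this lattice is modular. -/
def IsCompleteModularLattice (α : Type*) [inst : PartialOrder α] : Prop :=
  ∃ L : CompleteLattice α, L.toPartialOrder = inst ∧ IsModularLattice α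

/-- `d` is the dimension function of a lattice with least element: `d x` is the supremum of the
lengths of the chains that end in `x`, it increases by one along covering pairs, and it is a
valuation. -/
structure IsDimensionFunction {α : Type*} [PartialOrder α] (d : α → ℕ∞) : Prop where
  eq_height : ∀ x, d x = Order.height x
  covBy : ∀ x y, x ⋖ y → d y = d x + 1
  valuation : ∀ x y s i, IsLUB {x, y} s → IsGLB {x, y} i → d x + d y = d s + d i

/-- `d` is the dual dimension function: the dimension function of the order dual. -/
def IsDualDimensionFunction {α : Type*} [PartialOrder α] (d : α → ℕ∞) : Prop :=
  IsDimensionFunction (α := αᵒᵈ) fun x => d (OrderDual.ofDual x)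

namespace OrePoly

variable {K : Type*} [DivisionRing K] {S : K →+* K} {D : SDerivation S}

/-! ### Evaluation of products and left ideals of polynomials vanishing at a point -/

/-! The maps `vanishing` and `zeros` form an order-reversing Galois connection between subsets of
`K` and left ideals of `R`. Its closed sets are exactly the members of `FStar`. The ideal of an
algebraic set is generated by its minimal polynomial, and the ideal of any other set is `0`, so the
closed ideals correspond to `WStar`. The duality is then formal; the content lies in how sums of
ideals and degrees behave.

The main tool is the product formula `eval_mul`: if `g(a) ≠ 0`, then `(fg)(a) = f(b) g(a)`, where
`b` is the conjugate of `a` by `g(a)`. It has two consequences. First, adding a point outside the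
closure of an algebraic set multiplies the minimal polynomial on the left by a linear factor, so the
rank grows by exactly one (`rk_insert`). Hence the ideal of an algebraic set is already the ideal of
a finite set. Second, every left ideal `I` containing such an ideal is again a vanishing ideal
(`vanishing_zeros_of_le`): `R/I` embeds in a finite product of simple modules `R/R(t - a)`, and
membership in `I`, read off in coordinates, becomes vanishing at conjugates of the points `a`.

Consequently `vanishing` turns joins into intersections and meets into sums, and modularity comes
from the lattice of left ideals. Intervals of W-polynomials are governed by the correspondence
theorem for submodules. The rank is the height because it is strictly monotone and takes every
smaller value below a given set. It is a valuation because, on algebraic sets, it is the length of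
`R / vanishing S D Δ`, which is additive over sums and intersections. -/

/-- The `(S, D)`-conjugate `S(x) a x⁻¹ + D(x) x⁻¹` of `a` by `x`. -/
def conj (D : SDerivation S) (a x : K) : K := (S x * a + D.toAddMonoidHom x) * x⁻¹

theorem conj_mul {x : K} (a : K) (hx : x ≠ 0) :
    conj D a x * x = S x * a + D.toAddMonoidHom x := by
  rw [conj, inv_mul_cancel_right₀ hx]

theorem map_mul_derivation (a b : K) :
    D.toAddMonoidHom (a * b) = S a * D.toAddMonoidHom b + D.toAddMonoidHom a * b :=
  D.leibniz' a b

/-- Multiplication by `t` acts on values at `a` as `y ↦ S y * a + D y`. Applied to `y * x`, this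
operator gives the same operator for the conjugate of `a` by `x`, applied to `y`, times `x`. -/
theorem eval_tMul_pow {a : K} {g : OrePoly S D} (hg : eval a g ≠ 0) (n : ℕ) :
    eval a ((tMul ^ n : AddMonoid.End (OrePoly S D)) g) =
      powFun D (conj D a (eval a g)) n * eval a g := by
  induction n with
  | zero => exact (one_mul _).symm
  | succ n ih =>
    rw [pow_succ']
    change eval a (tMul ((tMul ^ n : AddMonoid.End (OrePoly S D)) g)) = _
    rw [eval_tMul, ih, powFun, map_mul, map_mul_derivation, add_mul, mul_assoc, mul_assoc,
      conj_mul a hg, mul_add, add_assoc]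

theorem eval_mul {a : K} (f : OrePoly S D) {g : OrePoly S D} (hg : eval a g ≠ 0) :
    eval a (f * g) = eval (conj D a (eval a g)) f * eval a g := by
  induction f using induction_on with
  | h n c => rw [monomial_mul, eval_smul, eval_tMul_pow hg, eval_monomial, mul_assoc]
  | h0 => simp
  | hadd f₁ f₂ h₁ h₂ => rw [add_mul, map_add, h₁, h₂, map_add, add_mul]

theorem eval_C (a b : K) : eval a (C b : OrePoly S D) = b := by
  rw [C, eval_monomial]; exact mul_one b

theorem mem_vanishing {Δ : Set K} {f : OrePoly S D} :
    f ∈ vanishing S D Δ ↔ ∀ a ∈ Δ, eval a f = 0 := Iff.rfl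

theorem mem_vanishing_singleton {a : K} {f : OrePoly S D} :
    f ∈ vanishing S D {a} ↔ eval a f = 0 := by simp [mem_vanishing]

theorem vanishing_anti {Δ Γ : Set K} (h : Δ ⊆ Γ) : vanishing S D Γ ≤ vanishing S D Δ :=
  fun _ hf a ha => hf a (h ha)

theorem vanishing_union (Δ Γ : Set K) :
    vanishing S D (Δ ∪ Γ) = vanishing S D Δ ⊓ vanishing S D Γ := by
  ext f
  simp only [Submodule.mem_inf, mem_vanishing, Set.mem_union, or_imp, forall_and]

/-- Modulo this ideal every `f` is congruent to the constant `f(a)`. A strictly larger left ideal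
therefore contains a nonzero constant, which is a unit. -/
theorem isCoatom_vanishing_singleton (a : K) : IsCoatom (vanishing S D {a}) := by
  constructor
  · intro h
    have h1 : (1 : OrePoly S D) ∈ vanishing S D {a} := h ▸ Submodule.mem_top
    rw [mem_vanishing_singleton, eval_one] at h1
    exact one_ne_zero h1
  · intro J hJ
    obtain ⟨f, hfJ, hf⟩ := SetLike.exists_of_lt hJ
    rw [mem_vanishing_singleton] at hf
    have h1 : f - C (eval a f) ∈ J := hJ.le <| mem_vanishing_singleton.2 <| by
      rw [map_sub, eval_C, sub_self]
    have h2 : C (eval a f) ∈ J := by simpa using J.sub_mem hfJ h1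
    rw [Ideal.eq_top_iff_one]
    have h3 := J.mul_mem_left (C (eval a f)⁻¹) h2
    rwa [C_mul, C, smul_monomial, inv_mul_cancel₀ hf] at h3

/-! ### The Galois connection between sets and left ideals -/

/-- The common zeros of a left ideal. -/
def zeros (I : Ideal (OrePoly S D)) : Set K := {a | ∀ f ∈ I, eval a f = 0}

theorem le_vanishing_iff {I : Ideal (OrePoly S D)} {Δ : Set K} :
    I ≤ vanishing S D Δ ↔ Δ ⊆ zeros I :=
  ⟨fun h _ ha _ hf => h hf _ ha, fun h _ hf _ ha => h ha _ hf⟩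

theorem subset_zeros_vanishing (Δ : Set K) : Δ ⊆ zeros (vanishing S D Δ) :=
  le_vanishing_iff.1 le_rfl

theorem le_vanishing_zeros (I : Ideal (OrePoly S D)) : I ≤ vanishing S D (zeros I) :=
  le_vanishing_iff.2 le_rfl

theorem vanishing_zeros_vanishing (Δ : Set K) :
    vanishing S D (zeros (vanishing S D Δ)) = vanishing S D Δ :=
  le_antisymm (vanishing_anti (subset_zeros_vanishing Δ)) (le_vanishing_zeros _)

theorem zeros_anti {I J : Ideal (OrePoly S D)} (h : I ≤ J) : zeros J ⊆ zeros I :=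
  fun _ ha f hf => ha f (h hf)

theorem mem_zeros_vanishing_iff {Δ : Set K} {a : K} :
    a ∈ zeros (vanishing S D Δ) ↔ vanishing S D Δ ≤ vanishing S D {a} := by
  rw [le_vanishing_iff, Set.singleton_subset_iff]

theorem vanishing_insert_of_mem {Δ : Set K} {a : K} (h : a ∈ zeros (vanishing S D Δ)) :
    vanishing S D (insert a Δ) = vanishing S D Δ := by
  rw [Set.insert_eq, vanishing_union, inf_eq_right]
  exact mem_zeros_vanishing_iff.1 h

theorem zeros_sup (I J : Ideal (OrePoly S D)) : zeros (I ⊔ J) = zeros I ∩ zeros J := by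
  apply Set.Subset.antisymm
  · exact Set.subset_inter (zeros_anti le_sup_left) (zeros_anti le_sup_right)
  · rintro a ⟨h₁, h₂⟩ f hf
    obtain ⟨g, hg, h, hh, rfl⟩ := Submodule.mem_sup.1 hf
    rw [map_add, h₁ g hg, h₂ h hh, add_zero]

theorem zeros_span_singleton (f : OrePoly S D) : zeros (Ideal.span {f}) = V f := by
  apply Set.Subset.antisymm
  · exact fun a ha => ha f (Ideal.mem_span_singleton_self f)
  · intro a ha g hg
    obtain ⟨q, rfl⟩ := Ideal.mem_span_singleton'.1 hg
    exact eval_mul_eq_zero a q f ha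

/-! ### Minimal polynomials -/

theorem isAlgebraicSet_iff {Δ : Set K} : IsAlgebraicSet S D Δ ↔ vanishing S D Δ ≠ ⊥ := by
  rw [Submodule.ne_bot_iff]
  constructor
  · rintro ⟨f, h0, hf⟩
    exact ⟨f, fun a ha => hf ha, h0⟩
  · rintro ⟨f, hf, h0⟩
    exact ⟨f, h0, fun a ha => hf a ha⟩

theorem IsAlgebraicSet.mono {Δ Γ : Set K} (hΓ : IsAlgebraicSet S D Γ) (h : Δ ⊆ Γ) :
    IsAlgebraicSet S D Δ := by
  obtain ⟨f, h0, hf⟩ := hΓ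
  exact ⟨f, h0, h.trans hf⟩

theorem minPoly_of_not_isAlgebraicSet {Δ : Set K} (h : ¬ IsAlgebraicSet S D Δ) :
    minPoly S D Δ = 0 := by
  unfold minPoly; rw [dif_neg h]

theorem span_minPoly (Δ : Set K) : Ideal.span {minPoly S D Δ} = vanishing S D Δ := by
  by_cases h : IsAlgebraicSet S D Δ
  · exact (isMinPoly_minPoly h).2.symm
  · rw [minPoly_of_not_isAlgebraicSet h, Ideal.span_singleton_zero]
    rw [isAlgebraicSet_iff, not_not] at h
    exact h.symm

theorem V_minPoly (Δ : Set K) : V (minPoly S D Δ) = zeros (vanishing S D Δ) := by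
  rw [← zeros_span_singleton, span_minPoly]

theorem minPoly_congr {Δ Γ : Set K} (h : vanishing S D Δ = vanishing S D Γ) :
    minPoly S D Δ = minPoly S D Γ := by
  by_cases hΔ : IsAlgebraicSet S D Δ
  · have hΓ : IsAlgebraicSet S D Γ := by rwa [isAlgebraicSet_iff, ← h, ← isAlgebraicSet_iff]
    exact (isMinPoly_minPoly hΔ).unique ⟨(isMinPoly_minPoly hΓ).1, h.trans (isMinPoly_minPoly hΓ).2⟩
  · have hΓ : ¬ IsAlgebraicSet S D Γ := by rwa [isAlgebraicSet_iff, ← h, ← isAlgebraicSet_iff]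
    rw [minPoly_of_not_isAlgebraicSet hΔ, minPoly_of_not_isAlgebraicSet hΓ]

theorem rk_congr {Δ Γ : Set K} (h : vanishing S D Δ = vanishing S D Γ) :
    rk S D Δ = rk S D Γ := by
  unfold rk
  rw [minPoly_congr h, isAlgebraicSet_iff, isAlgebraicSet_iff, h]

theorem rk_of_isAlgebraicSet {Δ : Set K} (h : IsAlgebraicSet S D Δ) :
    rk S D Δ = (minPoly S D Δ).natDegree := by
  unfold rk; rw [if_pos h]

theorem rk_of_not_isAlgebraicSet {Δ : Set K} (h : ¬ IsAlgebraicSet S D Δ) : rk S D Δ = ⊤ := by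
  unfold rk; rw [if_neg h]

theorem natDegree_one : (1 : OrePoly S D).natDegree = 0 := by
  apply natDegree_eq
  · intro k hk; rw [one_def, coeff_monomial, if_neg hk.ne]
  · rw [one_def, coeff_monomial]; simp

theorem rk_empty : rk S D (∅ : Set K) = 0 := by
  rw [rk_of_isAlgebraicSet isAlgebraicSet_empty, minPoly_empty, natDegree_one, Nat.cast_zero]

/-- A monic left multiple of a monic polynomial of no larger degree is that polynomial. -/
theorem Monic.eq_of_mem_span {f g : OrePoly S D} (hf : f.Monic) (hg : g.Monic)
    (h : f ∈ Ideal.span {g}) (hd : f.natDegree ≤ g.natDegree) : f = g := by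
  obtain ⟨q, rfl⟩ := Ideal.mem_span_singleton'.1 h
  have hq : q ≠ 0 := by rintro rfl; exact hf.ne_zero (zero_mul g)
  obtain ⟨hd', hc⟩ := natDegree_mul_monic hq hg
  have h0 : q.natDegree = 0 := by omega
  have hc' : (q * g).coeff (q.natDegree + g.natDegree) = 1 := by rw [← hd']; exact hf
  suffices q = 1 by rw [this, one_mul]
  apply ext_coeff
  intro k
  rw [one_def, coeff_monomial]
  split_ifs with hk
  · subst hk
    rw [← h0, ← hc, hc']
  · exact coeff_eq_zero_of_natDegree_lt (by omega)

theorem natDegree_lt_of_vanishing_lt {Δ Γ : Set K} (hΓ : IsAlgebraicSet S D Γ)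
    (h : vanishing S D Γ < vanishing S D Δ) :
    (minPoly S D Δ).natDegree < (minPoly S D Γ).natDegree := by
  have hΔ : IsAlgebraicSet S D Δ := by
    rw [isAlgebraicSet_iff] at hΓ ⊢
    exact ne_bot_of_le_ne_bot hΓ h.le
  -- If the degree did not grow, the larger ideal's generator would coincide with the smaller one's,
  -- since a monic left multiple of no larger degree is trivial.
  by_contra hle
  have hmem : minPoly S D Γ ∈ Ideal.span {minPoly S D Δ} := by
    rw [← (Ideal.span_singleton_le_iff_mem _), span_minPoly, span_minPoly]
    exact h.le
  have := (isMinPoly_minPoly hΓ).1.eq_of_mem_span (isMinPoly_minPoly hΔ).1 hmem (not_lt.1 hle)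
  rw [← span_minPoly, ← span_minPoly, this] at h
  exact lt_irrefl _ h

theorem rk_lt_of_vanishing_lt {Δ Γ : Set K} (hΔ : IsAlgebraicSet S D Δ)
    (h : vanishing S D Γ < vanishing S D Δ) : rk S D Δ < rk S D Γ := by
  by_cases hΓ : IsAlgebraicSet S D Γ
  · rw [rk_of_isAlgebraicSet hΔ, rk_of_isAlgebraicSet hΓ]
    exact_mod_cast natDegree_lt_of_vanishing_lt hΓ h
  · rw [rk_of_isAlgebraicSet hΔ, rk_of_not_isAlgebraicSet hΓ]
    exact ENat.natCast_lt_top _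

/-! ### Linear polynomials, single points, and adding a point to a set -/

/-- The monic linear polynomial `t - b`. -/
noncomputable def linear (b : K) : OrePoly S D := T - C b

theorem coeff_linear (b : K) (k : ℕ) :
    (linear b : OrePoly S D).coeff k = (if 1 = k then 1 else 0) - (if 0 = k then b else 0) := by
  rw [linear, coeff_sub, T, C, coeff_monomial, coeff_monomial]

theorem natDegree_linear (b : K) : (linear b : OrePoly S D).natDegree = 1 := by
  apply natDegree_eq
  · intro k hk
    rw [coeff_linear, if_neg hk.ne, if_neg (by omega), sub_zero]
  · simp [coeff_linear]

theorem monic_linear (b : K) : (linear b : OrePoly S D).Monic := by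
  rw [Monic, natDegree_linear]; simp [coeff_linear]

theorem Monic.eq_linear {f : OrePoly S D} (hf : f.Monic) (hd : f.natDegree = 1) :
    f = linear (-f.coeff 0) := by
  apply ext_coeff
  intro k
  rw [coeff_linear]
  rcases k with - | - | k
  · simp
  · rw [Monic, hd] at hf; simp [hf]
  · rw [coeff_eq_zero_of_natDegree_lt (by omega)]; simp

theorem eval_linear (a b : K) : eval a (linear b : OrePoly S D) = a - b := by
  have h1 : D.toAddMonoidHom 1 = 0 := by simpa using map_mul_derivation (D := D) 1 1
  rw [linear, map_sub, eval_C, T, eval_monomial, powFun, powFun, h1]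
  simp

theorem vanishing_singleton_ne_bot (a : K) : vanishing S D {a} ≠ ⊥ := by
  rw [Submodule.ne_bot_iff]
  exact ⟨linear a, mem_vanishing_singleton.2 (by rw [eval_linear, sub_self]),
    (monic_linear a).ne_zero⟩

theorem zeros_vanishing_singleton (a : K) : zeros (vanishing S D {a}) = {a} := by
  apply Set.Subset.antisymm _ (subset_zeros_vanishing _)
  intro b hb
  have := hb (linear a) (mem_vanishing_singleton.2 (by rw [eval_linear, sub_self]))
  rw [eval_linear, sub_eq_zero] at this
  exact this

theorem minPoly_singleton (a : K) : minPoly S D {a} = linear a := by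
  have hA : IsAlgebraicSet S D {a} := isAlgebraicSet_iff.2 (vanishing_singleton_ne_bot a)
  refine (isMinPoly_minPoly hA).unique ⟨monic_linear a, ?_⟩
  have hle : Ideal.span {linear a} ≤ vanishing S D {a} := by
    rw [Ideal.span_singleton_le_iff_mem, mem_vanishing_singleton, eval_linear, sub_self]
  have hmem : linear a ∈ Ideal.span {minPoly S D {a}} := by
    rw [span_minPoly]
    exact hle (Ideal.mem_span_singleton_self _)
  -- The ideal is proper, because `1` does not vanish at `a`. Comparison with the empty set, whose
  -- ideal is everything, then excludes degree `0`.
  have hpos : 0 < (minPoly S D {a}).natDegree := by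
    have h := natDegree_lt_of_vanishing_lt (Δ := ∅) hA
      (lt_of_le_of_ne (vanishing_anti (Set.empty_subset _)) fun h => by
        have h1 : (1 : OrePoly S D) ∈ vanishing S D {a} := h ▸ fun a ha => absurd ha id
        rw [mem_vanishing_singleton, eval_one] at h1
        exact one_ne_zero h1)
    omega
  rw [(monic_linear a).eq_of_mem_span (isMinPoly_minPoly hA).1 hmem
    (by rw [natDegree_linear]; exact hpos), span_minPoly]

/-- With `g` the minimal polynomial of `Δ` and `b` the conjugate of `a` by `g(a)`, the product `(t -
b) g` vanishes on `Δ` and, by the product formula, at `a`. This bounds the new degree by `deg g +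
1`, while the strict drop of the vanishing ideal forces it above `deg g`. -/
theorem rk_insert {Δ : Set K} {a : K} (hΔ : IsAlgebraicSet S D Δ)
    (ha : a ∉ zeros (vanishing S D Δ)) :
    IsAlgebraicSet S D (insert a Δ) ∧ rk S D (insert a Δ) = rk S D Δ + 1 := by
  have hm := (isMinPoly_minPoly hΔ).1
  have hg : eval a (minPoly S D Δ) ≠ 0 := by rw [← V_minPoly] at ha; exact ha
  obtain ⟨hd, -⟩ := natDegree_mul_monic
    (monic_linear (D := D) (conj D a (eval a (minPoly S D Δ)))).ne_zero hm
  set p := linear (conj D a (eval a (minPoly S D Δ))) * minPoly S D Δ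
  have hpm : p ∈ vanishing S D (insert a Δ) := by
    rw [Set.insert_eq, vanishing_union]
    refine ⟨mem_vanishing_singleton.2 ?_, ?_⟩
    · rw [eval_mul _ hg, eval_linear, sub_self, zero_mul]
    · rw [← span_minPoly]
      exact Ideal.mul_mem_left _ _ (Ideal.mem_span_singleton_self _)
  rw [natDegree_linear] at hd
  have hp0 : p ≠ 0 := by
    intro h
    have h0 : (0 : OrePoly S D).natDegree = 0 := Finset.sup_empty
    rw [h, h0] at hd
    omega
  have hA : IsAlgebraicSet S D (insert a Δ) :=
    isAlgebraicSet_iff.2 ((Submodule.ne_bot_iff _).2 ⟨p, hpm, hp0⟩)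
  refine ⟨hA, ?_⟩
  rw [rk_of_isAlgebraicSet hΔ, rk_of_isAlgebraicSet hA]
  have hlt := natDegree_lt_of_vanishing_lt (Δ := Δ) hA
    (lt_of_le_of_ne (vanishing_anti (Set.subset_insert _ _)) fun h => ha <| by
      rw [← h]; exact subset_zeros_vanishing _ (Set.mem_insert _ _))
  have hle : (minPoly S D (insert a Δ)).natDegree ≤ 1 + (minPoly S D Δ).natDegree := by
    rw [← hd]
    rw [← span_minPoly] at hpm
    obtain ⟨q, hq⟩ := Ideal.mem_span_singleton'.1 hpm
    have hq0 : q ≠ 0 := by rintro rfl; exact hp0 (by rw [← hq, zero_mul])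
    rw [← hq, (natDegree_mul_monic hq0 (isMinPoly_minPoly hA).1).1]
    omega
  have : (minPoly S D (insert a Δ)).natDegree = (minPoly S D Δ).natDegree + 1 := by omega
  exact_mod_cast this

/-! ### Left ideals above the vanishing ideal of an algebraic set -/

/-- If no finite set had the same ideal, points of `Δ` outside the current closure could be added
forever. Each raises the rank by one, eventually past the degree of the minimal polynomial of `Δ`.
-/
theorem IsAlgebraicSet.exists_finset {Δ : Set K} (hΔ : IsAlgebraicSet S D Δ) :
    ∃ F : Finset K, vanishing S D (F : Set K) = vanishing S D Δ := by
  classical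
  by_contra! hne
  have key : ∀ n : ℕ, ∃ F : Finset K, (F : Set K) ⊆ Δ ∧
      rk S D (F : Set K) = n := by
    intro n
    induction n with
    | zero => exact ⟨∅, by simp, by simp [rk_empty]⟩
    | succ n ih =>
      obtain ⟨F, hF, hn⟩ := ih
      obtain ⟨a, haΔ, ha⟩ : ∃ a ∈ Δ, a ∉ zeros (vanishing S D (F : Set K)) := by
        by_contra! h
        exact hne F (le_antisymm (le_vanishing_iff.2 h) (vanishing_anti hF))
      refine ⟨insert a F, ?_, ?_⟩
      · rw [Finset.coe_insert]; exact Set.insert_subset haΔ hF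
      · rw [Finset.coe_insert, (rk_insert (hΔ.mono hF) ha).2, hn]; push_cast; rfl
  obtain ⟨F, hF, hn⟩ := key ((minPoly S D Δ).natDegree + 1)
  rcases (vanishing_anti hF).eq_or_lt with h | h
  · exact hne F h.symm
  · have := natDegree_lt_of_vanishing_lt hΔ h
    rw [rk_of_isAlgebraicSet (hΔ.mono hF)] at hn
    have hn : (minPoly S D (F : Set K)).natDegree = (minPoly S D Δ).natDegree + 1 := by
      exact_mod_cast hn
    omega

theorem IsAlgebraicSet.insert {Δ : Set K} (hΔ : IsAlgebraicSet S D Δ) (a : K) :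
    IsAlgebraicSet S D (insert a Δ) := by
  by_cases ha : a ∈ zeros (vanishing S D Δ)
  · rwa [isAlgebraicSet_iff, vanishing_insert_of_mem ha, ← isAlgebraicSet_iff]
  · exact (rk_insert hΔ ha).1

theorem IsAlgebraicSet.union {Δ Γ : Set K} (hΔ : IsAlgebraicSet S D Δ)
    (hΓ : IsAlgebraicSet S D Γ) : IsAlgebraicSet S D (Δ ∪ Γ) := by
  classical
  obtain ⟨F, hF⟩ := hΓ.exists_finset
  rw [isAlgebraicSet_iff, vanishing_union, ← hF, ← vanishing_union, ← isAlgebraicSet_iff]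
  clear hF
  induction F using Finset.induction_on with
  | empty => simpa using hΔ
  | insert a F _ ih => rw [Finset.coe_insert, Set.union_insert]; exact ih.insert a

/-- Every left ideal containing the vanishing ideal of an algebraic set is a vanishing ideal. -/
theorem vanishing_zeros_of_le {Δ : Set K} (hΔ : IsAlgebraicSet S D Δ) {I : Ideal (OrePoly S D)}
    (hI : vanishing S D Δ ≤ I) : vanishing S D (zeros I) = I := by
  refine le_antisymm (fun r hr => ?_) (le_vanishing_zeros I)
  obtain ⟨F, hF⟩ := hΔ.exists_finset
  rw [← hF] at hI
  have hs : ∀ a : F, IsSimpleModule (OrePoly S D) (OrePoly S D ⧸ vanishing S D {(a : K)}) :=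
    fun a => isSimpleModule_iff_isCoatom.2 (isCoatom_vanishing_singleton _)
  -- The target is a finite product of simple modules, hence semisimple, and the kernel of `π` is
  -- the ideal of `F`.
  let π : OrePoly S D →ₗ[OrePoly S D] ∀ a : F, OrePoly S D ⧸ vanishing S D {(a : K)} :=
    LinearMap.pi fun a => (vanishing S D {(a : K)}).mkQ
  have hπ : LinearMap.ker π ≤ I := by
    refine fun f hf => hI fun a ha => ?_
    have h := congrFun (LinearMap.mem_ker.1 hf) ⟨a, ha⟩
    exact mem_vanishing_singleton.1 ((Submodule.Quotient.mk_eq_zero _).1 h)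
  -- Semisimplicity splits the quotient by the image of `I`, so `R/I` embeds back into the product.
  obtain ⟨σ, hσ⟩ := IsSemisimpleModule.lifting_property (Submodule.map π I).mkQ
    (Submodule.mkQ_surjective _) LinearMap.id
  have hmem : ∀ f : OrePoly S D, f ∈ I ↔ σ ((Submodule.map π I).mkQ (π f)) = 0 := by
    intro f
    have hinj : Function.Injective σ := fun x y h => by
      have := congrArg (Submodule.map π I).mkQ h
      rwa [← LinearMap.comp_apply, ← LinearMap.comp_apply, hσ] at this
    rw [map_eq_zero_iff _ hinj, Submodule.mkQ_apply, Submodule.Quotient.mk_eq_zero,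
      ← Submodule.mem_comap, Submodule.comap_map_eq, sup_eq_left.2 hπ]
  -- The embedding is determined by the image of `1`; `p a` represents its coordinate at `a`. Thus
  -- `f ∈ I` means that `f * p a` vanishes at `a` for every `a` in `F`.
  choose p hp using fun a : F => Submodule.Quotient.mk_surjective _ (σ ((Submodule.map π I).mkQ (π 1)) a)
  have hmem' : ∀ f : OrePoly S D, f ∈ I ↔ ∀ a : F, eval (a : K) (f * p a) = 0 := by
    intro f
    have h1 : σ ((Submodule.map π I).mkQ (π f)) = f • σ ((Submodule.map π I).mkQ (π 1)) := by
      rw [← map_smul, ← map_smul, ← map_smul, smul_eq_mul, mul_one]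
    rw [hmem, h1, funext_iff]
    refine forall_congr' fun a => ?_
    rw [Pi.smul_apply, ← hp, ← Submodule.Quotient.mk_smul, Pi.zero_apply,
      Submodule.Quotient.mk_eq_zero, mem_vanishing_singleton, smul_eq_mul]
  rw [hmem']
  intro a
  by_cases h0 : eval (a : K) (p a) = 0
  · exact eval_mul_eq_zero _ _ _ h0
  -- By the product formula it suffices that `r` vanishes at the conjugate of `a` by the value of `p
  -- a`. That conjugate is a common zero of `I`, by the same formula applied to members of `I`.
  · rw [eval_mul _ h0, hr _ fun f hf => ?_, zero_mul]
    have h := (hmem' f).1 hf a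
    rw [eval_mul _ h0] at h
    exact (mul_eq_zero.1 h).resolve_right h0

/-! ### The lattice of full algebraic sets -/

/-- Only `0` vanishes on a non-algebraic set, so its closure is all of `K`. The set adjoined to the
full algebraic sets is thus the one remaining closed set. -/
theorem mem_FStar_iff {Δ : Set K} : Δ ∈ FStar S D ↔ zeros (vanishing S D Δ) = Δ := by
  have key : ¬ IsAlgebraicSet S D Δ → zeros (vanishing S D Δ) = Set.univ := by
    intro h
    rw [isAlgebraicSet_iff, not_not] at h
    rw [h, Set.eq_univ_iff_forall]
    rintro a f hf
    rw [(Submodule.mem_bot _).1 hf, map_zero]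
  constructor
  · rintro (h | ⟨h, rfl⟩)
    · rw [← V_minPoly]; exact h.2
    · exact key h
  · intro h
    by_cases hΔ : IsAlgebraicSet S D Δ
    · exact Or.inl ⟨hΔ, (V_minPoly Δ).trans h⟩
    · have hu : Δ = Set.univ := h.symm.trans (key hΔ)
      exact Or.inr ⟨hu ▸ hΔ, hu⟩

theorem zeros_mem_FStar (I : Ideal (OrePoly S D)) : zeros I ∈ FStar S D :=
  mem_FStar_iff.2 <| Set.Subset.antisymm (zeros_anti (le_vanishing_zeros I))
    (subset_zeros_vanishing _)

theorem zeros_vanishing (Δ : FStar S D) : zeros (vanishing S D (Δ : Set K)) = Δ :=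
  mem_FStar_iff.1 Δ.2

theorem vanishing_le_vanishing_iff {Δ Γ : FStar S D} :
    vanishing S D (Γ : Set K) ≤ vanishing S D (Δ : Set K) ↔ Δ ≤ Γ := by
  rw [le_vanishing_iff, zeros_vanishing]; rfl

theorem vanishing_lt_vanishing_iff {Δ Γ : FStar S D} :
    vanishing S D (Γ : Set K) < vanishing S D (Δ : Set K) ↔ Δ < Γ := by
  rw [lt_iff_le_not_ge, lt_iff_le_not_ge, vanishing_le_vanishing_iff, vanishing_le_vanishing_iff]

theorem FStar.isAlgebraicSet_of_lt {Δ Γ : FStar S D} (h : Δ < Γ) :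
    IsAlgebraicSet S D (Δ : Set K) := by
  rw [isAlgebraicSet_iff]
  exact ne_bot_of_gt (vanishing_lt_vanishing_iff.2 h)

/-- The join of two full algebraic sets. -/
def FStar.join (Δ Γ : FStar S D) : FStar S D :=
  ⟨zeros (vanishing S D (Δ : Set K) ⊓ vanishing S D (Γ : Set K)), zeros_mem_FStar _⟩

/-- The intersection of two full algebraic sets. -/
def FStar.meet (Δ Γ : FStar S D) : FStar S D :=
  ⟨Δ ∩ Γ, by
    have h := zeros_mem_FStar (vanishing S D (Δ : Set K) ⊔ vanishing S D (Γ : Set K))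
    rwa [zeros_sup, zeros_vanishing, zeros_vanishing] at h⟩

theorem FStar.vanishing_join (Δ Γ : FStar S D) :
    vanishing S D (FStar.join Δ Γ : Set K) = vanishing S D (Δ : Set K) ⊓ vanishing S D Γ := by
  change vanishing S D (zeros (vanishing S D (Δ : Set K) ⊓ vanishing S D (Γ : Set K))) = _
  rw [← vanishing_union, vanishing_zeros_vanishing]

theorem FStar.isLUB_join (Δ Γ : FStar S D) : IsLUB {Δ, Γ} (FStar.join Δ Γ) := by
  have h : ∀ Θ : FStar S D, FStar.join Δ Γ ≤ Θ ↔ Δ ≤ Θ ∧ Γ ≤ Θ := fun Θ => by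
    rw [← vanishing_le_vanishing_iff, vanishing_join, le_inf_iff, vanishing_le_vanishing_iff,
      vanishing_le_vanishing_iff]
  constructor
  · rintro _ (rfl | rfl)
    exacts [((h _).1 le_rfl).1, ((h _).1 le_rfl).2]
  · exact fun Θ hΘ => (h Θ).2 ⟨hΘ (Set.mem_insert _ _), hΘ (Set.mem_insert_of_mem _ rfl)⟩

theorem FStar.isGLB_meet (Δ Γ : FStar S D) : IsGLB {Δ, Γ} (FStar.meet Δ Γ) := by
  constructor
  · rintro _ (rfl | rfl)
    exacts [Set.inter_subset_left, Set.inter_subset_right]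
  · exact fun Θ hΘ =>
      Set.subset_inter (hΘ (Set.mem_insert _ _)) (hΘ (Set.mem_insert_of_mem _ rfl))

/-- Unlike the formula for joins, this is not formal: the sum of the two ideals must itself be a
vanishing ideal, which `vanishing_zeros_of_le` supplies as soon as one of the sets is algebraic. -/
theorem FStar.vanishing_meet (Δ Γ : FStar S D) :
    vanishing S D (FStar.meet Δ Γ : Set K) = vanishing S D (Δ : Set K) ⊔ vanishing S D Γ := by
  have hz : (FStar.meet Δ Γ : Set K) =
      zeros (vanishing S D (Δ : Set K) ⊔ vanishing S D (Γ : Set K)) := by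
    rw [zeros_sup, zeros_vanishing, zeros_vanishing]; rfl
  rw [hz]
  by_cases hΔ : IsAlgebraicSet S D (Δ : Set K)
  · exact vanishing_zeros_of_le hΔ le_sup_left
  · by_cases hΓ : IsAlgebraicSet S D (Γ : Set K)
    · exact vanishing_zeros_of_le hΓ le_sup_right
    -- If neither set is algebraic, both ideals are `0`, and so is their sum.
    · rw [← zeros_vanishing Δ, ← zeros_vanishing Γ] at *
      rw [isAlgebraicSet_iff, not_not] at hΔ hΓ
      rw [hΔ, hΓ, sup_bot_eq, ← hΔ]
      exact vanishing_zeros_vanishing _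

theorem isCompleteModularLattice_FStar : IsCompleteModularLattice (FStar S D) := by
  let _ : InfSet (FStar S D) :=
    ⟨fun s => ⟨zeros (⨆ Δ ∈ s, vanishing S D (Δ : Set K)), zeros_mem_FStar _⟩⟩
  have hle : ∀ (s : Set (FStar S D)) (Θ : FStar S D), Θ ≤ sInf s ↔ ∀ Δ ∈ s, Θ ≤ Δ := by
    intro s Θ
    change (Θ : Set K) ⊆ zeros _ ↔ _
    rw [← le_vanishing_iff, iSup₂_le_iff]
    exact forall₂_congr fun Δ _ => vanishing_le_vanishing_iff
  let L : CompleteLattice (FStar S D) := completeLatticeOfInf (FStar S D) fun s =>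
    ⟨fun Δ hΔ => (hle s _).1 le_rfl Δ hΔ, fun Θ hΘ => (hle s Θ).2 hΘ⟩
  refine ⟨L, rfl, ⟨fun {x} y {z} hxz => ?_⟩⟩
  have hsup : ∀ a b : FStar S D, a ⊔ b = FStar.join a b := fun a b =>
    isLUB_pair.unique (FStar.isLUB_join a b)
  have hinf : ∀ a b : FStar S D, a ⊓ b = FStar.meet a b := fun a b =>
    isGLB_pair.unique (FStar.isGLB_meet a b)
  rw [hsup, hsup, hinf, hinf, ← vanishing_le_vanishing_iff]
  simp only [FStar.vanishing_join, FStar.vanishing_meet]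
  have hzx := vanishing_le_vanishing_iff.2 hxz
  -- Under the order reversal the required inequality becomes the modular law for left ideals, with
  -- the roles of `x` and `z` exchanged.
  refine le_trans (le_of_eq ?_) ((IsModularLattice.sup_inf_le_assoc_of_le
    (vanishing S D (y : Set K)) hzx).trans (le_of_eq ?_)) <;> ac_rfl

/-! ### Rank -/

theorem FStar.rk_strictMono : StrictMono fun Δ : FStar S D => rk S D (Δ : Set K) :=
  fun _ _ h => rk_lt_of_vanishing_lt (isAlgebraicSet_of_lt h) (vanishing_lt_vanishing_iff.2 h)

/-- The witness is the closure of `Δ` together with one point of `Γ` outside it. -/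
theorem FStar.exists_rk_add_one {Δ Γ : FStar S D} (h : Δ < Γ) :
    ∃ Θ : FStar S D, Δ < Θ ∧ Θ ≤ Γ ∧ rk S D (Θ : Set K) = rk S D (Δ : Set K) + 1 := by
  obtain ⟨a, haΓ, haΔ⟩ := Set.exists_of_ssubset h
  have ha : a ∉ zeros (vanishing S D (Δ : Set K)) := by rwa [zeros_vanishing]
  refine ⟨⟨zeros (vanishing S D (insert a (Δ : Set K))), zeros_mem_FStar _⟩, ?_, ?_, ?_⟩
  · have hle : insert a (Δ : Set K) ⊆ zeros (vanishing S D (insert a (Δ : Set K))) :=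
      subset_zeros_vanishing _
    refine ⟨(Set.subset_insert _ _).trans hle, fun hle' => haΔ (hle' (hle (Set.mem_insert _ _)))⟩
  · change zeros _ ⊆ (Γ : Set K)
    rw [← zeros_vanishing Γ]
    exact zeros_anti (vanishing_anti (Set.insert_subset haΓ h.le))
  · rw [← (rk_insert (isAlgebraicSet_of_lt h) ha).2]
    exact rk_congr (vanishing_zeros_vanishing _)

theorem FStar.exists_lt_rk_eq (Δ : FStar S D) {n : ℕ∞} (hn : n < rk S D (Δ : Set K)) :
    ∃ Γ < Δ, rk S D (Γ : Set K) = n := by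
  lift n to ℕ using hn.ne_top
  induction n with
  | zero =>
    refine ⟨⊥, lt_of_le_of_ne bot_le ?_, rk_empty⟩
    rintro rfl
    rw [show ((⊥ : FStar S D) : Set K) = ∅ from rfl, rk_empty] at hn
    exact absurd hn (lt_irrefl _)
  | succ n ih =>
    obtain ⟨Γ, hΓ, hr⟩ := ih (lt_trans (by exact_mod_cast n.lt_succ_self) hn)
    obtain ⟨Θ, -, hΘ, hr'⟩ := exists_rk_add_one hΓ
    rw [hr] at hr'
    refine ⟨Θ, lt_of_le_of_ne hΘ ?_, by rw [hr']; rfl⟩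
    rintro rfl
    rw [hr'] at hn
    exact absurd hn (lt_irrefl _)

theorem FStar.rk_eq_height (Δ : FStar S D) : rk S D (Δ : Set K) = Order.height Δ := by
  rw [Order.height_eq_of_strictMono _ FStar.rk_strictMono fun Δ _ h => exists_lt_rk_eq Δ h,
    Order.height_enat]

theorem FStar.rk_of_covBy {Δ Γ : FStar S D} (h : Δ ⋖ Γ) :
    rk S D (Γ : Set K) = rk S D (Δ : Set K) + 1 := by
  obtain ⟨Θ, h₁, h₂, hr⟩ := exists_rk_add_one h.lt
  rcases h₂.eq_or_lt with rfl | h₂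
  · exact hr
  · exact absurd h₂ (h.2 h₁)

end OrePoly

/-! ### Module length and the valuation property of the rank -/

/-- Additivity of the length of quotients over sums and intersections of submodules. -/
theorem Submodule.length_quotient_inf_add_length_quotient_sup {R M : Type*} [Ring R]
    [AddCommGroup M] [Module R M] (p q : Submodule R M) :
    Module.length R (M ⧸ p ⊓ q) + Module.length R (M ⧸ p ⊔ q) =
      Module.length R (M ⧸ p) + Module.length R (M ⧸ q) := by
  rw [← Module.length_prod R (M ⧸ p) (M ⧸ q)]
  -- The exact sequence `0 → M/(p ⊓ q) → M/p × M/q → M/(p ⊔ q) → 0`, whose second map is the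
  -- difference.
  let f : (M ⧸ p ⊓ q) →ₗ[R] (M ⧸ p) × (M ⧸ q) :=
    (Submodule.factor inf_le_left).prod (Submodule.factor inf_le_right)
  let g : (M ⧸ p) × (M ⧸ q) →ₗ[R] M ⧸ p ⊔ q :=
    (Submodule.factor le_sup_left).coprod (-Submodule.factor le_sup_right)
  refine (Module.length_eq_add_of_exact f g ?_ ?_ ?_).symm
  · rw [injective_iff_map_eq_zero]
    intro x hx
    obtain ⟨x, rfl⟩ := Submodule.Quotient.mk_surjective _ x
    obtain ⟨h₁, h₂⟩ := Prod.mk.inj hx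
    exact (Submodule.Quotient.mk_eq_zero _).2
      ⟨(Submodule.Quotient.mk_eq_zero _).1 h₁, (Submodule.Quotient.mk_eq_zero _).1 h₂⟩
  · intro x
    obtain ⟨x, rfl⟩ := Submodule.Quotient.mk_surjective _ x
    exact ⟨(Submodule.Quotient.mk x, 0), by simp [g, Submodule.factor]⟩
  · rintro ⟨x, y⟩
    obtain ⟨x, rfl⟩ := Submodule.Quotient.mk_surjective _ x
    obtain ⟨y, rfl⟩ := Submodule.Quotient.mk_surjective _ y
    have hg : g (Submodule.Quotient.mk x, Submodule.Quotient.mk y) =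
        Submodule.Quotient.mk (x - y) := by
      simp [g, Submodule.factor, sub_eq_add_neg]
    rw [hg, Submodule.Quotient.mk_eq_zero]
    constructor
    · intro h
      obtain ⟨i, hi, j, hj, hij⟩ := Submodule.mem_sup.1 h
      -- From `x - y = i + j` one gets `x - i = y + j`, which agrees with `x` modulo `p` and with
      -- `y` modulo `q`.
      refine ⟨Submodule.Quotient.mk (x - i), Prod.ext ?_ ?_⟩
      · refine (Submodule.Quotient.eq _).2 ?_
        rw [LinearMap.id_apply, sub_sub_cancel_left]; exact p.neg_mem hi
      · refine (Submodule.Quotient.eq _).2 ?_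
        rw [LinearMap.id_apply, show x - i - y = j by rw [eq_sub_of_add_eq' hij]; abel]; exact hj
    · rintro ⟨z, hz⟩
      obtain ⟨z, rfl⟩ := Submodule.Quotient.mk_surjective _ z
      obtain ⟨h₁, h₂⟩ := Prod.mk.inj hz
      have h₁ := (Submodule.Quotient.eq p).1 h₁
      have h₂ := (Submodule.Quotient.eq q).1 h₂
      rw [show x - y = -(z - x) + (z - y) by abel]
      exact Submodule.add_mem_sup (p.neg_mem h₁) h₂

namespace OrePoly

variable {K : Type*} [DivisionRing K] {S : K →+* K} {D : SDerivation S}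

/-- Build a finite set with the same ideal point by point. A new point outside the closure
contributes a maximal left ideal not containing the old one, so the two sum to `R` and the length
rises by one, as the rank does. -/
theorem IsAlgebraicSet.rk_eq_length {Δ : Set K} (hΔ : IsAlgebraicSet S D Δ) :
    rk S D Δ = Module.length (OrePoly S D) (OrePoly S D ⧸ vanishing S D Δ) := by
  classical
  obtain ⟨F, hF⟩ := hΔ.exists_finset
  have hFA : IsAlgebraicSet S D (F : Set K) := by
    rwa [isAlgebraicSet_iff, hF, ← isAlgebraicSet_iff]
  rw [← rk_congr hF, ← hF]
  clear hF hΔ Δ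
  induction F using Finset.induction_on with
  | empty =>
    rw [Finset.coe_empty, rk_empty, eq_comm, Module.length_eq_zero_iff,
      Submodule.Quotient.subsingleton_iff, eq_top_iff]
    exact fun f _ a ha => absurd ha (Set.notMem_empty a)
  | insert a F _ ih =>
    rw [Finset.coe_insert] at hFA ⊢
    have hA := hFA.mono (Set.subset_insert a _)
    have ih := ih hA
    by_cases ha : a ∈ zeros (vanishing S D (F : Set K))
    · rw [rk_congr (vanishing_insert_of_mem ha), ih, vanishing_insert_of_mem ha]
    · have hs : IsSimpleModule (OrePoly S D) (OrePoly S D ⧸ vanishing S D {a}) :=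
        isSimpleModule_iff_isCoatom.2 (isCoatom_vanishing_singleton _)
      have htop : vanishing S D {a} ⊔ vanishing S D (F : Set K) = ⊤ :=
        (isCoatom_vanishing_singleton a).2 _ (left_lt_sup.2 (mt mem_zeros_vanishing_iff.2 ha))
      have h := Submodule.length_quotient_inf_add_length_quotient_sup
        (vanishing S D {a}) (vanishing S D (F : Set K))
      rw [htop, Module.length_eq_one (OrePoly S D) (OrePoly S D ⧸ vanishing S D {a}), ← ih, ← vanishing_union, ← Set.insert_eq,
        Module.length_eq_zero_iff.2 (Submodule.Quotient.subsingleton_iff.2 rfl),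
        add_zero] at h
      rw [(rk_insert hA ha).2, h, add_comm]

theorem FStar.rk_add_rk (Δ Γ : FStar S D) : rk S D (Δ : Set K) + rk S D (Γ : Set K) =
    rk S D (FStar.join Δ Γ : Set K) + rk S D (FStar.meet Δ Γ : Set K) := by
  have hub := (isLUB_join Δ Γ).1
  have h₁ : Δ ≤ FStar.join Δ Γ := hub (Set.mem_insert _ _)
  have h₂ : Γ ≤ FStar.join Δ Γ := hub (Set.mem_insert_of_mem _ rfl)
  by_cases hs : IsAlgebraicSet S D (FStar.join Δ Γ : Set K)
  · rw [(hs.mono h₁).rk_eq_length, (hs.mono h₂).rk_eq_length, hs.rk_eq_length,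
      ((hs.mono h₁).mono (Δ := (FStar.meet Δ Γ : Set K)) Set.inter_subset_left).rk_eq_length,
      vanishing_join, vanishing_meet, Submodule.length_quotient_inf_add_length_quotient_sup]
  · rw [rk_of_not_isAlgebraicSet hs, top_add]
    -- A union of two algebraic sets is algebraic, so an infinite rank of the join must come from
    -- one of the two sets, and both sides are `⊤`.
    suffices ¬ IsAlgebraicSet S D (Δ : Set K) ∨ ¬ IsAlgebraicSet S D (Γ : Set K) by
      rcases this with h | h
      · rw [rk_of_not_isAlgebraicSet h, top_add]
      · rw [rk_of_not_isAlgebraicSet h, add_top]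
    by_contra! h
    refine hs (isAlgebraicSet_iff.2 ?_)
    rw [vanishing_join, ← vanishing_union, ← isAlgebraicSet_iff]
    exact h.1.union h.2

theorem FStar.isDimensionFunction_rk :
    IsDimensionFunction fun Δ : FStar S D => rk S D (Δ : Set K) where
  eq_height := rk_eq_height
  covBy _ _ := rk_of_covBy
  valuation x y s i hs hi := by
    rw [hs.unique (isLUB_join x y), hi.unique (isGLB_meet x y)]
    exact rk_add_rk x y

/-! ### Wedderburn polynomials -/

/-- A minimal polynomial depends only on the vanishing ideal, which a set shares with its closure.
The polynomial `0` fits in because it is the default minimal polynomial of a non-algebraic set. -/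
theorem mem_WStar_iff {f : OrePoly S D} : f ∈ WStar S D ↔ minPoly S D (V f) = f := by
  constructor
  · rintro (⟨Δ, hΔ, rfl⟩ | ⟨h, rfl⟩)
    · rw [V_minPoly]
      exact minPoly_congr (vanishing_zeros_vanishing Δ)
    · rw [show V (0 : OrePoly S D) = Set.univ from
        Set.eq_univ_iff_forall.2 fun a => map_zero (eval a), minPoly_of_not_isAlgebraicSet h]
  · intro h
    by_cases hV : IsAlgebraicSet S D (V f)
    · exact Or.inl ⟨V f, hV, h.symm⟩
    · rw [minPoly_of_not_isAlgebraicSet hV] at h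
      subst h
      rw [show V (0 : OrePoly S D) = Set.univ from
        Set.eq_univ_iff_forall.2 fun a => map_zero (eval a)] at hV
      exact Or.inr ⟨hV, rfl⟩

theorem minPoly_mem_WStar (Δ : Set K) : minPoly S D Δ ∈ WStar S D := by
  rw [mem_WStar_iff, V_minPoly]
  exact minPoly_congr (vanishing_zeros_vanishing Δ)

theorem V_mem_FStar (f : OrePoly S D) : V f ∈ FStar S D :=
  zeros_span_singleton f ▸ zeros_mem_FStar _

/-- The duality between full algebraic sets and Wedderburn polynomials. -/
noncomputable def fStarOrderIso (S : K →+* K) (D : SDerivation S) :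
    FStar S D ≃o (WStar S D)ᵒᵈ where
  toFun Δ := OrderDual.toDual ⟨minPoly S D (Δ : Set K), minPoly_mem_WStar _⟩
  invFun f := ⟨V ((OrderDual.ofDual f : WStar S D) : OrePoly S D), V_mem_FStar _⟩
  left_inv Δ := Subtype.ext <| (V_minPoly _).trans (zeros_vanishing Δ)
  right_inv f := congrArg OrderDual.toDual <| Subtype.ext <|
    mem_WStar_iff.1 (OrderDual.ofDual f).2
  map_rel_iff' {Δ Γ} := by
    change Ideal.span {minPoly S D (Γ : Set K)} ≤ Ideal.span {minPoly S D (Δ : Set K)} ↔ _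
    rw [span_minPoly, span_minPoly, vanishing_le_vanishing_iff]

/-- The two conventions for infinity match: the ideal of `V f` is `Rf`, so `V f` is non-algebraic
exactly when `f = 0`. -/
theorem degTop_eq_rk {f : OrePoly S D} (hf : f ∈ WStar S D) : degTop f = rk S D (V f) := by
  have h := mem_WStar_iff.1 hf
  have hiff : IsAlgebraicSet S D (V f) ↔ f ≠ 0 := by
    rw [isAlgebraicSet_iff, ← span_minPoly, h, Ne, Ideal.span_singleton_eq_bot]
  unfold degTop rk
  rw [h]
  by_cases h0 : f = 0
  · rw [if_pos h0, if_neg (by rw [hiff, not_not]; exact h0)]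
  · rw [if_neg h0, if_pos (hiff.2 h0)]

end OrePoly

/-! ### Transport along order isomorphisms and dualities -/

theorem IsDimensionFunction.comp_orderIso {α β : Type*} [PartialOrder α] [PartialOrder β]
    {d : α → ℕ∞} (hd : IsDimensionFunction d) (e : β ≃o α) :
    IsDimensionFunction fun x => d (e x) where
  eq_height x := by rw [hd.eq_height, Order.height_orderIso]
  covBy x y h := hd.covBy _ _ ((apply_covBy_apply_iff e).2 h)
  valuation x y s i hs hi := by
    apply hd.valuation
    · rw [← Set.image_pair]; exact e.isLUB_image'.2 hs
    · rw [← Set.image_pair]; exact e.isGLB_image'.2 hi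

theorem IsCompleteModularLattice.of_orderIso {α β : Type*} [PartialOrder α] [inst : PartialOrder β]
    (h : IsCompleteModularLattice α) (e : α ≃o βᵒᵈ) : IsCompleteModularLattice β := by
  obtain ⟨L, rfl, hm⟩ := h
  -- Infima in `β` are images of suprema in `α`, as `e` reverses the order.
  let _ : InfSet β := ⟨fun s => OrderDual.ofDual (e (sSup {x | OrderDual.ofDual (e x) ∈ s}))⟩
  have hle : ∀ (x : α) (b : β), x ≤ e.symm (OrderDual.toDual b) ↔ b ≤ OrderDual.ofDual (e x) :=
    fun x b => by rw [e.le_symm_apply]; rfl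
  let L' : CompleteLattice β := completeLatticeOfInf β fun s => by
    refine ⟨fun b hb => ?_, fun b hb => ?_⟩
    · have := le_sSup (a := e.symm (OrderDual.toDual b))
        (s := {x | OrderDual.ofDual (e x) ∈ s}) (by simpa using hb)
      exact (e.symm_apply_le).1 this
    · refine (hle _ b).1 (sSup_le fun x hx => (hle x b).2 (hb hx))
  refine ⟨L', rfl, ⟨fun {x} y {z} hxz => ?_⟩⟩
  let φ : βᵒᵈ ≃o α := e.symm
  have hsup : ∀ a b : β, φ (OrderDual.toDual (a ⊔ b)) =
      φ (OrderDual.toDual a) ⊓ φ (OrderDual.toDual b) := fun a b => φ.map_inf _ _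
  have hinf : ∀ a b : β, φ (OrderDual.toDual (a ⊓ b)) =
      φ (OrderDual.toDual a) ⊔ φ (OrderDual.toDual b) := fun a b => φ.map_sup _ _
  rw [← OrderDual.toDual_le_toDual, ← φ.le_iff_le, hsup, hinf, hinf, hsup]
  have hzx : φ (OrderDual.toDual z) ≤ φ (OrderDual.toDual x) := φ.le_iff_le.2 hxz
  refine le_trans (le_of_eq ?_) ((IsModularLattice.sup_inf_le_assoc_of_le
    (φ (OrderDual.toDual y)) hzx).trans (le_of_eq ?_)) <;> ac_rfl
namespace OrePoly

variable {K : Type*} [DivisionRing K] {S : K →+* K} {D : SDerivation S}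

/-! ### W-polynomials, their zero sets, and single points -/

theorem W_subset_WStar : W S D ⊆ WStar S D := fun _ => Or.inl

theorem vanishing_V {f : OrePoly S D} (hf : f ∈ WStar S D) :
    vanishing S D (V f) = Ideal.span {f} := by
  rw [← span_minPoly, mem_WStar_iff.1 hf]

theorem mem_W_of_isAlgebraicSet {Δ : Set K} (hΔ : IsAlgebraicSet S D Δ) :
    minPoly S D Δ ∈ W S D := ⟨Δ, hΔ, rfl⟩

theorem isAlgebraicSet_V {f : OrePoly S D} (hf : f ∈ W S D) : IsAlgebraicSet S D (V f) :=
  ⟨f, (monic_of_mem_W hf).ne_zero, Set.Subset.rfl⟩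

theorem isAlgebraicSet_singleton (a : K) : IsAlgebraicSet S D {a} :=
  isAlgebraicSet_iff.2 (vanishing_singleton_ne_bot a)

theorem singleton_mem_FStar (a : K) : ({a} : Set K) ∈ FStar S D :=
  mem_FStar_iff.2 (zeros_vanishing_singleton a)

theorem linear_mem_W (a : K) : (linear a : OrePoly S D) ∈ W S D :=
  ⟨{a}, isAlgebraicSet_singleton a, (minPoly_singleton a).symm⟩

theorem span_linear (a : K) : Ideal.span {(linear a : OrePoly S D)} = vanishing S D {a} := by
  rw [← minPoly_singleton, span_minPoly]

/-! ### Atoms and coatoms -/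

theorem isAtom_singleton (a : K) : IsAtom (⟨{a}, singleton_mem_FStar a⟩ : FStar S D) := by
  constructor
  · intro h
    exact Set.singleton_ne_empty a (congrArg Subtype.val h)
  · intro Δ hΔ
    exact Subtype.ext (Set.ssubset_singleton_iff.1 hΔ)

theorem image_atoms_FStar :
    Subtype.val '' {Δ : FStar S D | IsAtom Δ} = {Δ : Set K | ∃ a : K, Δ = {a}} := by
  apply Set.Subset.antisymm
  · rintro _ ⟨Δ, hΔ, rfl⟩
    obtain ⟨a, ha⟩ : (Δ : Set K).Nonempty := by
      rw [Set.nonempty_iff_ne_empty]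
      exact fun h => hΔ.1 (Subtype.ext h)
    have hle : (⟨{a}, singleton_mem_FStar a⟩ : FStar S D) ≤ Δ := Set.singleton_subset_iff.2 ha
    exact ⟨a, (congrArg Subtype.val ((hΔ.le_iff_eq (isAtom_singleton a).1).1 hle)).symm⟩
  · rintro _ ⟨a, rfl⟩
    exact ⟨_, isAtom_singleton a, rfl⟩

/-- The left ideal of `t - a` is already maximal among all left ideals, so a W-polynomial strictly
above it generates `R` and, being monic, is `1`. -/
theorem isCoatom_linear (a : K) : IsCoatom (⟨linear a, linear_mem_W a⟩ : W S D) := by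
  have hc := isCoatom_vanishing_singleton (S := S) (D := D) a
  rw [← span_linear] at hc
  constructor
  · intro h
    have h1 : linear a = (1 : OrePoly S D) := congrArg Subtype.val h
    exact hc.1 (by rw [h1, Ideal.span_singleton_one])
  · intro f hf
    have h1 : Ideal.span {(f : OrePoly S D)} = ⊤ := hc.2 _ hf
    refine Subtype.ext (eq_of_span_eq (monic_of_mem_W f.2) monic_one ?_)
    rw [h1]
    exact Ideal.span_singleton_one.symm

theorem image_coatoms_W :
    Subtype.val '' {f : W S D | IsCoatom f} = {f : OrePoly S D | f.Monic ∧ f.natDegree = 1} := by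
  apply Set.Subset.antisymm
  · rintro _ ⟨f, hf, rfl⟩
    -- A W-polynomial is the minimal polynomial of its zero set, so one without zeros would be `1`.
    -- A zero `a` then places `f` below `t - a`.
    obtain ⟨a, ha⟩ : (V (f : OrePoly S D)).Nonempty := by
      rw [Set.nonempty_iff_ne_empty]
      intro h
      refine hf.1 (Subtype.ext ?_)
      change (f : OrePoly S D) = 1
      rw [← mem_WStar_iff.1 (W_subset_WStar f.2), h, minPoly_empty]
    have hle : f ≤ ⟨linear a, linear_mem_W a⟩ := by
      change Ideal.span {(f : OrePoly S D)} ≤ Ideal.span {linear a}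
      rw [span_linear, Ideal.span_singleton_le_iff_mem, mem_vanishing_singleton]
      exact ha
    rw [← (hf.le_iff_eq (isCoatom_linear a).1).1 hle]
    exact ⟨monic_linear a, natDegree_linear a⟩
  · rintro f ⟨hm, hd⟩
    exact ⟨_, isCoatom_linear (-f.coeff 0), (hm.eq_linear hd).symm⟩

/-! ### Intervals -/

/-- Submodules of `Rh/Rf` are the left ideals between `Rf` and `Rh`. Each contains the vanishing
ideal `Rf` of the algebraic set `V f`, so it is a vanishing ideal, generated by a W-polynomial. -/
theorem nonempty_Icc_orderIso_submodule (f h : W S D) (hfh : f ≤ h) :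
    Nonempty (Set.Icc f h ≃o Submodule (OrePoly S D)
      (↥(Ideal.span {(h : OrePoly S D)}) ⧸
        Submodule.submoduleOf (Ideal.span {(f : OrePoly S D)})
          (Ideal.span {(h : OrePoly S D)}))) := by
  set I := Ideal.span {(f : OrePoly S D)}
  set J := Ideal.span {(h : OrePoly S D)}
  have hIJ : I ≤ J := hfh
  let ψ : Submodule (OrePoly S D) (J ⧸ Submodule.submoduleOf I J) ↪o Ideal (OrePoly S D) :=
    (Submodule.comapMkQOrderEmbedding _).trans (Submodule.MapSubtype.orderEmbedding J)
  have hψ : ∀ N, ψ N = Submodule.map J.subtype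
      (Submodule.comap (Submodule.submoduleOf I J).mkQ N) := fun _ => rfl
  have hψJ : ∀ N, ψ N ≤ J := fun N => Submodule.map_subtype_le J _
  have hIψ : ∀ N, I ≤ ψ N := fun N x hx =>
    ⟨⟨x, hIJ hx⟩, Submodule.le_comap_mkQ _ N hx, rfl⟩
  have hvI : vanishing S D (V (f : OrePoly S D)) = I := vanishing_V (W_subset_WStar f.2)
  have hspan : ∀ N, Ideal.span {minPoly S D (zeros (ψ N))} = ψ N := fun N => by
    rw [span_minPoly, vanishing_zeros_of_le (isAlgebraicSet_V f.2)]
    rw [hvI]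
    exact hIψ N
  have hW : ∀ N, minPoly S D (zeros (ψ N)) ∈ W S D := fun N => by
    refine mem_W_of_isAlgebraicSet ((isAlgebraicSet_V f.2).mono ?_)
    rw [← zeros_span_singleton]
    exact zeros_anti (hIψ N)
  let φ : Submodule (OrePoly S D) (J ⧸ Submodule.submoduleOf I J) ↪o Set.Icc f h :=
    OrderEmbedding.ofMapLEIff
      (fun N => ⟨⟨_, hW N⟩, by
        change I ≤ Ideal.span {_}
        rw [hspan]; exact hIψ N, by
        change Ideal.span {_} ≤ J
        rw [hspan]; exact hψJ N⟩) fun N N' => by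
        change Ideal.span {_} ≤ Ideal.span {_} ↔ _
        rw [hspan, hspan, ψ.le_iff_le]
  refine ⟨(RelIso.ofSurjective φ fun g => ?_).symm⟩
  have hIg : I ≤ Ideal.span {((g : W S D) : OrePoly S D)} := g.2.1
  have hgJ : Ideal.span {((g : W S D) : OrePoly S D)} ≤ J := g.2.2
  -- The preimage under the correspondence: the image of `Rg` in `Rh/Rf`.
  let N := Submodule.map (Submodule.submoduleOf I J).mkQ
    (Submodule.submoduleOf (Ideal.span {((g : W S D) : OrePoly S D)}) J)
  have hN : ψ N = Ideal.span {((g : W S D) : OrePoly S D)} := by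
    rw [hψ, Submodule.comap_map_mkQ, sup_eq_right.2 (Submodule.comap_mono hIg),
      Submodule.submoduleOf, Submodule.map_comap_subtype, inf_eq_right.2 hgJ]
  refine ⟨N, Subtype.ext (Subtype.ext ?_)⟩
  exact eq_of_span_eq (monic_of_mem_W (hW N)) (monic_of_mem_W g.1.2) ((hspan N).trans hN)

/-! ### The degree as dual dimension function, and the theorem -/

theorem isDualDimensionFunction_degTop :
    IsDualDimensionFunction fun f : WStar S D => degTop (f : OrePoly S D) := by
  have h := FStar.isDimensionFunction_rk.comp_orderIso (fStarOrderIso S D).symm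
  have he : (fun f : (WStar S D)ᵒᵈ => degTop ((OrderDual.ofDual f : WStar S D) : OrePoly S D)) =
      fun f => rk S D ((fStarOrderIso S D).symm f : Set K) :=
    funext fun f => degTop_eq_rk (OrderDual.ofDual f).2
  unfold IsDualDimensionFunction
  rw [he]
  exact h

end OrePoly

theorem theorem7p5 {K : Type*} [DivisionRing K] (S : K →+* K) (D : SDerivation S) :
    -- (1) complete modular lattices and mutually inverse dualities
    (IsCompleteModularLattice (OrePoly.FStar S D) ∧
      IsCompleteModularLattice (OrePoly.WStar S D) ∧
      ∃ e : OrePoly.FStar S D ≃o (OrePoly.WStar S D)ᵒᵈ,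
        (∀ Δ : OrePoly.FStar S D,
          ((OrderDual.ofDual (e Δ) : OrePoly.WStar S D) : OrePoly S D) =
            OrePoly.minPoly S D (Δ : Set K)) ∧
        (∀ f : OrePoly.WStar S D,
          ((e.symm (OrderDual.toDual f) : OrePoly.FStar S D) : Set K) =
            OrePoly.V (f : OrePoly S D))) ∧
    -- (2) rank and degree
    (IsDimensionFunction (fun Δ : OrePoly.FStar S D => OrePoly.rk S D (Δ : Set K)) ∧
      IsDualDimensionFunction
        (fun f : OrePoly.WStar S D => OrePoly.degTop (f : OrePoly S D))) ∧
    -- (3) atoms, and maximal elements below the largest element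
    ((Subtype.val '' {Δ : OrePoly.FStar S D | IsAtom Δ} = {Δ : Set K | ∃ a : K, Δ = {a}}) ∧
      (Subtype.val '' {f : OrePoly.W S D | IsCoatom f} =
        {f : OrePoly S D | f.Monic ∧ f.natDegree = 1})) ∧
    -- (4) intervals
    (∀ f h : OrePoly.W S D, f ≤ h →
      Nonempty (Set.Icc f h ≃o Submodule (OrePoly S D)
        (↥(Ideal.span {(h : OrePoly S D)}) ⧸
          Submodule.submoduleOf (Ideal.span {(f : OrePoly S D)})
            (Ideal.span {(h : OrePoly S D)})))) := by
  exact ⟨⟨OrePoly.isCompleteModularLattice_FStar,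
      OrePoly.isCompleteModularLattice_FStar.of_orderIso (OrePoly.fStarOrderIso S D),
      OrePoly.fStarOrderIso S D, fun _ => rfl, fun _ => rfl⟩,
    ⟨OrePoly.FStar.isDimensionFunction_rk, OrePoly.isDualDimensionFunction_degTop⟩,
    ⟨OrePoly.image_atoms_FStar, OrePoly.image_coatoms_W⟩,
    OrePoly.nonempty_Icc_orderIso_submodule⟩
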